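/- Let $M$ be a smooth manifold of dimension $n$ (Hausdorff, second countable, without boundary). A $d$-web of hypersurfaces on $M$ is a collection of $d$ foliations of codimension one, the $i$-th one being given near every point by a smooth 1-form $\omega_i\neq 0$ with $\omega_i\wedge d\omega_i=0$, such that any $n$ of the forms $\omega_1,\dots,\omega_d$ are linearly independent at every point. For a smooth torsion-free affine connection $\nabla$ let $d^s_\nabla\omega$ denote the symmetrization of the covariant differential $\nabla\omega$ of a 1-form $\omega$, and let $\theta\cdot\omega$ denote the symmetric product of 1-forms. Two torsion-free connections $\nabla,\nabla'$ are projectively equivalent if there is a smooth 1-form $\rho$ with $d^s_\nabla\omega-d^s_{\nabla'}\omega=\rho\cdot\omega$ for all 1-forms $\omega$; a projective structure is an equivalence class of this relation. A web is geodesic for $\nabla$ if the leaves of all its foliations are totally geodesic for $\nabla$. **Theorem.** 1. For every $(n+2)$-web of hypersurfaces on $M$ there is exactly one projective structure such that the web is geodesic for all connections in it; it is called the canonical projective structure of the web. It consists of all torsion-free connections for which the web is geodesic. 2. Near every point the forms of the web can be chosen so that $\omega_1+\dots+\omega_n+\omega_{n+1}=0$, and then $a_1\omega_1+\dots+a_n\omega_n+\omega_{n+2}=0$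 for some functions $a_i$. Let $\partial_1,\dots,\partial_n$ be the frame dual to $\omega_1,\dots,\omega_n$ and put $$s_{ij}=\frac{1}{a_i-a_j}\,(a_i\partial_j-a_j\partial_i)\log\left|\frac{a_j}{a_i}\right|\quad(i\neq j),\qquad s_{ii}=0 .$$ A torsion-free connection $\nabla$ belongs to the canonical projective structure if and only if, for all forms normalized in this way on an open set $U$, there is a smooth 1-form $\theta_{n+1}$ on $U$ such that on $U$ $$d^s_\nabla\omega_i=\theta_i\cdot\omega_i,\qquad \theta_i=\theta_{n+1}+\sum_{j=1}^n s_{ij}\,\omega_j,\qquad i=1,\dots,n .$$ In that case also $d^s_\nabla\omega_{n+1}=\theta_{n+1}\cdot\omega_{n+1}$ on $U$, and $\theta_{n+1}$ determines $\nabla$ on $U$. If normalized forms are given on all of $M$, then every smooth 1-form $\theta_{n+1}$ on $M$ occurs for some connection in the canonical projective structure. 3. Let $d\geq n+2$ and let a $d$-web be geodesic for some torsion-free connection on $M$. Then all $(n+2)$-subwebs of the $d$-web have the same canonical projective structure. -/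

import Mathlib

open scoped Manifold ContDiff Topology

noncomputable section

namespace HypersurfaceWeb

/-! Throughout, `M` is a smooth manifold of dimension `n` without boundary. Vector fields and
one-forms are total functions on `M`; the ones that live on an open set only are used there only. -/

/-- A vector field on `M` (no regularity is built in). -/
abbrev VField (n : ℕ) (M : Type*) [TopologicalSpace M]
    [ChartedSpace (EuclideanSpace ℝ (Fin n)) M] : Type _ :=
  (x : M) → TangentSpace (𝓡 n) x

/-- A differential one-form on `M` (no regularity is built in). -/
abbrev OneForm (n : ℕ) (M : Type*) [TopologicalSpace M]
    [ChartedSpace (EuclideanSpace ℝ (Fin n)) M] : Type _ :=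
  (x : M) → TangentSpace (𝓡 n) x →L[ℝ] ℝ

section Basic

variable {n : ℕ} {M : Type*} [TopologicalSpace M] [ChartedSpace (EuclideanSpace ℝ (Fin n)) M]

/-- The vector field `X` is smooth on a neighbourhood of `x`. -/
def SmoothFieldAt [IsManifold (𝓡 n) ∞ M] (X : VField n M) (x : M) : Prop :=
  ContMDiffAt (𝓡 n) ((𝓡 n).prod 𝓘(ℝ, EuclideanSpace ℝ (Fin n))) ∞
    (fun y : M => Bundle.TotalSpace.mk' (EuclideanSpace ℝ (Fin n))
      (E := (TangentSpace (𝓡 n) : M → Type _)) y (X y)) x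

/-- The one-form `η` is smooth on a neighbourhood of `x`, as a section of the cotangent bundle. -/
def SmoothFormAt [IsManifold (𝓡 n) ∞ M] (η : OneForm n M) (x : M) : Prop :=
  ContMDiffAt (𝓡 n) ((𝓡 n).prod 𝓘(ℝ, EuclideanSpace ℝ (Fin n) →L[ℝ] ℝ)) ∞
    (fun y : M => Bundle.TotalSpace.mk' (EuclideanSpace ℝ (Fin n) →L[ℝ] ℝ)
      (E := fun y : M => TangentSpace (𝓡 n) y →L[ℝ] Bundle.Trivial M ℝ y) y (η y)) x

/-- The derivative `X f` of a function along a vector field. -/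
def dirDeriv (X : VField n M) (f : M → ℝ) (x : M) : ℝ :=
  mvfderiv (𝓡 n) f x (X x)

/-- The exterior derivative `dη (X, Y) = X (η Y) - Y (η X) - η [X, Y]`. -/
def extD (η : OneForm n M) (X Y : VField n M) (x : M) : ℝ :=
  dirDeriv X (fun y => η y (Y y)) x - dirDeriv Y (fun y => η y (X y)) x
    - η x (VectorField.mlieBracket (𝓡 n) X Y x)

/-- The three-form `η ∧ dη`, evaluated on three vector fields. -/
def wedgeExtD (η : OneForm n M) (X Y Z : VField n M) (x : M) : ℝ :=
  η x (X x) * extD η Y Z x + η x (Y x) * extD η Z X x + η x (Z x) * extD η X Y x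

/-- The symmetric product `θ · η` of two one-forms, evaluated on two vector fields. -/
def symProd (θ η : OneForm n M) (X Y : VField n M) (x : M) : ℝ :=
  (θ x (X x) * η x (Y x) + θ x (Y x) * η x (X x)) / 2

end Basic

section Manifold

variable (n : ℕ) (M : Type*) [TopologicalSpace M] [ChartedSpace (EuclideanSpace ℝ (Fin n)) M]
  [IsManifold (𝓡 n) ∞ M]

/-- A smooth torsion-free affine connection on `M`. -/
structure TorsionFreeConnection where
  /-- The covariant derivative: `cov Y x v` is the derivative of `Y` in the direction `v`. -/
  cov : CovariantDerivative (𝓡 n) (EuclideanSpace ℝ (Fin n)) (TangentSpace (𝓡 n) : M → Type _)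
  smooth : CovariantDerivative.ContMDiffCovariantDerivative cov ∞
  torsion_eq_zero : cov.torsion = 0

variable {n M}

/-- The symmetric part of the covariant differential of a one-form, for the connection induced
on the cotangent bundle: `(∇_X η) Y = X (η Y) - η (∇_X Y)`. -/
def symCovDiff (D : TorsionFreeConnection n M) (η : OneForm n M) (X Y : VField n M) (x : M) : ℝ :=
  ((dirDeriv X (fun y => η y (Y y)) x - η x (D.cov Y x (X x)))
    + (dirDeriv Y (fun y => η y (X y)) x - η x (D.cov X x (Y x)))) / 2

/-- Projective equivalence: there is a smooth one-form `ρ` such that the symmetric covariant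
differentials differ by `ρ · η` for all (locally defined) smooth one-forms `η`. -/
def ProjEquiv (D D' : TorsionFreeConnection n M) : Prop :=
  ∃ ρ : OneForm n M, (∀ x, SmoothFormAt ρ x) ∧
    ∀ (x : M) (η : OneForm n M) (X Y : VField n M),
      SmoothFormAt η x → SmoothFieldAt X x → SmoothFieldAt Y x →
        symCovDiff D η X Y x - symCovDiff D' η X Y x = symProd ρ η X Y x

theorem SmoothFormAt.zero (x : M) : SmoothFormAt (0 : OneForm n M) x :=
  Bundle.contMDiffAt_zeroSection ℝ (fun y : M => TangentSpace (𝓡 n) y →L[ℝ] Bundle.Trivial M ℝ y)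

theorem SmoothFormAt.neg {η : OneForm n M} {x : M} (h : SmoothFormAt η x) :
    SmoothFormAt (-η) x :=
  ContMDiffAt.neg_section h

theorem SmoothFormAt.sum {η η' : OneForm n M} {x : M} (h : SmoothFormAt η x)
    (h' : SmoothFormAt η' x) : SmoothFormAt (η + η') x :=
  ContMDiffAt.add_section h h'

theorem projEquiv_equivalence : Equivalence (ProjEquiv (n := n) (M := M)) where
  refl D := ⟨0, SmoothFormAt.zero, fun x η X Y _ _ _ => by simp [symProd]⟩
  symm := by
    rintro D D' ⟨ρ, hρ, h⟩
    refine ⟨-ρ, fun x => (hρ x).neg, fun x η X Y hη hX hY => ?_⟩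
    have := h x η X Y hη hX hY
    simp only [symProd, Pi.neg_apply, neg_apply] at this ⊢
    linarith
  trans := by
    rintro D D' D'' ⟨ρ, hρ, h⟩ ⟨ρ', hρ', h'⟩
    refine ⟨ρ + ρ', fun x => (hρ x).sum (hρ' x), fun x η X Y hη hX hY => ?_⟩
    have h1 := h x η X Y hη hX hY
    have h2 := h' x η X Y hη hX hY
    simp only [symProd, Pi.add_apply, add_apply] at h1 h2 ⊢
    linarith

variable (n M) in
/-- A projective structure on `M`: a class of projectively equivalent torsion-free connections. -/
def ProjectiveStructure : Type _ :=
  Quotient (⟨ProjEquiv, projEquiv_equivalence⟩ : Setoid (TorsionFreeConnection n M))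

/-- The projective structure (projective class) of a torsion-free connection. -/
def TorsionFreeConnection.projClass (D : TorsionFreeConnection n M) : ProjectiveStructure n M :=
  Quotient.mk _ D

/-- The one-forms `η i` define on `U` a web of `d` foliations of codimension one: they are smooth
and nowhere zero, satisfy `η ∧ dη = 0`, and any `n` of them are linearly independent. -/
structure IsWebOn {d : ℕ} (U : Set M) (η : Fin d → OneForm n M) : Prop where
  smooth : ∀ i, ∀ x ∈ U, SmoothFormAt (η i) x
  ne_zero : ∀ i, ∀ x ∈ U, η i x ≠ 0
  integrable : ∀ i, ∀ x ∈ U, ∀ X Y Z : VField n M,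
    SmoothFieldAt X x → SmoothFieldAt Y x → SmoothFieldAt Z x → wedgeExtD (η i) X Y Z x = 0
  independent : ∀ x ∈ U, ∀ σ : Fin n ↪ Fin d, LinearIndependent ℝ (fun k => η (σ k) x)

variable (n M) in
/-- A `d`-web of hypersurfaces on `M`: `d` foliations of codimension one, recorded by their tangent
hyperplanes, which are given near every point by one-forms as in `IsWebOn`. -/
structure Web (d : ℕ) where
  /-- The tangent space at `x` of the leaf of the `i`-th foliation through `x`. -/
  tangent : Fin d → (x : M) → Submodule ℝ (TangentSpace (𝓡 n) x)
  locally_given : ∀ x : M, ∃ U : Set M, IsOpen U ∧ x ∈ U ∧ ∃ η : Fin d → OneForm n M,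
    IsWebOn U η ∧ ∀ i, ∀ y ∈ U, tangent i y = LinearMap.ker (η i y).toLinearMap

namespace Web

variable {d : ℕ}

/-- On `U`, the web `W` is the web `⟨η 1, …, η d⟩`. -/
def IsGivenBy (W : Web n M d) (U : Set M) (η : Fin d → OneForm n M) : Prop :=
  IsWebOn U η ∧ ∀ i, ∀ y ∈ U, W.tangent i y = LinearMap.ker (η i y).toLinearMap

/-- The subweb formed by the foliations number `σ 0, σ 1, …`. -/
def subweb {k : ℕ} (W : Web n M d) (σ : Fin k ↪ Fin d) : Web n M k where
  tangent i := W.tangent (σ i)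
  locally_given x := by
    obtain ⟨U, hU, hx, η, hη, h⟩ := W.locally_given x
    exact ⟨U, hU, hx, fun i => η (σ i),
      ⟨fun i => hη.smooth (σ i), fun i => hη.ne_zero (σ i), fun i => hη.integrable (σ i),
        fun y hy τ => hη.independent y hy (τ.trans σ)⟩, fun i => h (σ i)⟩

/-- The leaves of the `i`-th foliation are totally geodesic for the torsion-free connection `D`:
if `X` and `Y` are tangent to the leaves, so is the covariant derivative of `Y` along `X`. -/
def LeavesTotallyGeodesic (W : Web n M d) (D : TorsionFreeConnection n M) (i : Fin d) : Prop :=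
  ∀ (x : M) (X Y : VField n M), SmoothFieldAt X x → SmoothFieldAt Y x →
    (∀ᶠ y in 𝓝 x, X y ∈ W.tangent i y) → (∀ᶠ y in 𝓝 x, Y y ∈ W.tangent i y) →
      D.cov Y x (X x) ∈ W.tangent i x

/-- The web is geodesic for `D`: the leaves of all its foliations are totally geodesic. -/
def IsGeodesic (W : Web n M d) (D : TorsionFreeConnection n M) : Prop :=
  ∀ i, W.LeavesTotallyGeodesic D i

/-- The web is geodesic for the projective structure `P`, that is, for all connections in it. -/
def IsGeodesicIn (W : Web n M d) (P : ProjectiveStructure n M) : Prop :=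
  ∀ D : TorsionFreeConnection n M, D.projClass = P → W.IsGeodesic D

/-- On the open set `U` the `(n+2)`-web `W` is given by forms `η` in the normalization
`η_1 + … + η_n + η_{n+1} = 0`, `a_1 η_1 + … + a_n η_n + η_{n+2} = 0`, and the fields `e j` are the
frame dual to the coframe `η_1, …, η_n`. -/
structure IsNormalized (W : Web n M (n + 2)) (U : Set M) (η : Fin (n + 2) → OneForm n M)
    (e : Fin n → VField n M) (a : Fin n → M → ℝ) : Prop where
  isOpen : IsOpen U
  isGivenBy : W.IsGivenBy U η
  dual : ∀ x ∈ U, ∀ i j : Fin n, η (Fin.castAdd 2 i) x (e j x) = if i = j then 1 else 0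
  sum_eq_zero : ∀ x ∈ U, ∑ i : Fin n, η (Fin.castAdd 2 i) x + η (Fin.natAdd n 0) x = 0
  combination_eq_zero : ∀ x ∈ U,
    ∑ i : Fin n, a i x • η (Fin.castAdd 2 i) x + η (Fin.natAdd n 1) x = 0

end Web

/-- The functions `s_ij = (a_i - a_j)⁻¹ (a_i ∂_j - a_j ∂_i) log (a_j / a_i)` for `i ≠ j`, and
`s_ii = 0`. (`Real.log` is the logarithm of the absolute value.) -/
def sCoeff (e : Fin n → VField n M) (a : Fin n → M → ℝ) (i j : Fin n) (x : M) : ℝ :=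
  if i = j then 0 else
    (a i x - a j x)⁻¹ *
      (a i x * dirDeriv (e j) (fun y => Real.log (a j y / a i y)) x
        - a j x * dirDeriv (e i) (fun y => Real.log (a j y / a i y)) x)

/-- On `U`, the symmetric covariant differential of `η` is `θ · η`. -/
def SymCovDiffEq (D : TorsionFreeConnection n M) (U : Set M) (η θ : OneForm n M) : Prop :=
  ∀ x ∈ U, ∀ X Y : VField n M, SmoothFieldAt X x → SmoothFieldAt Y x →
    symCovDiff D η X Y x = symProd θ η X Y x

/-- On `U`, the connection `D` is given by the forms `θ_i = θ + ∑ j, s_ij η_j`, `i = 1, …, n`: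
the symmetric covariant differential of `η_i` is `θ_i · η_i`. -/
def IsGivenByForms (D : TorsionFreeConnection n M) (U : Set M) (η : Fin (n + 2) → OneForm n M)
    (e : Fin n → VField n M) (a : Fin n → M → ℝ) (θ : OneForm n M) : Prop :=
  ∀ i : Fin n, SymCovDiffEq D U (η (Fin.castAdd 2 i))
    (fun x => θ x + ∑ j : Fin n, sCoeff e a i j x • η (Fin.castAdd 2 j) x)

end Manifold

end HypersurfaceWeb

end

/-! The theorem rests on three facts about a torsion-free connection `∇`.

A foliation given by an integrable form `η` has totally geodesic leaves exactly if the symmetric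
covariant differential of `η`, a symmetric bilinear form at every point, vanishes on pairs of
vectors in the kernel of `η` (`geodesic_iff_symForm`), that is, if it is a symmetric product `θ · η`
(`exists_eq_symMul`). What remains is linear algebra at one point.

Let an `(n+2)`-web be given by normalized forms. If the first `n` foliations are geodesic, the
symmetric covariant differentials of `η_1, …, η_n` are `θ_i · η_i`. Those of `η_{n+1}` and `η_{n+2}`
are then known by the Leibniz rule, and the last two foliations are geodesic if and only if
`θ_i = θ + ∑ j, s_ij η_j` with a common `θ`. The condition is necessary: the vectors `e_i - e_j` and
`a_j e_i - a_i e_j`, which are annihilated by `η_{n+1}` and `η_{n+2}`, give for every pair `i ≠ j`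
two linear equations for `θ_i (e_j)` and `θ_j (e_i)`, with determinant proportional to `a_i - a_j`
(`eq_symMul_of_vanish`). It is sufficient since the remaining terms are contractions of symmetric
with antisymmetric matrices (`sum_symMul_eq`, `sum_symMul_vanish`). Together these describe all
connections for which the web is geodesic (`Web.IsNormalized.symForm_of_geodesicAt`,
`Web.IsNormalized.geodesicAt_of_symForm`). As the coefficients `s_ij` depend on the web only, the
symmetric covariant differentials of such connections differ by the symmetric product with
`ρ = θ - θ'`, so that they are projectively equivalent (`Web.IsGeodesic.projEquiv`); conversely a
term `ρ · η` vanishes on pairs of vectors in the kernel of `η`, so geodesic webs stay geodesic in a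
projective class (`Web.IsGeodesic.of_projEquiv`).

Finally, a torsion-free connection with symmetric covariant differentials `φ_i · η_i` exists for
every coframe `η_i` and all `φ_i`: it is defined by
`η_i (∇_X Y) = X (η_i Y) - (φ_i · η_i) (X, Y) - dη_i (X, Y) / 2`
(`coframeCov`), the torsion being zero by the formula for the exterior derivative. Geodesic
connections thus exist locally for every `θ`, and a partition of unity glues them
(`exists_torsionFreeConnection`), the condition to be geodesic being linear in the values of the
connection. -/

noncomputable section

namespace HypersurfaceWeb

open Bundle

/-! ### Dual bases -/

section DualBasis

variable {V : Type*} [AddCommGroup V] [Module ℝ V] [FiniteDimensional ℝ V] {n : ℕ}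

theorem eq_sum_of_dual (hV : Module.finrank ℝ V = n) {η : Fin n → V → ℝ} {e : Fin n → V}
    (hlin : ∀ i, IsLinearMap ℝ (η i)) (hd : ∀ i j, η i (e j) = if i = j then 1 else 0) (v : V) :
    v = ∑ i, η i v • e i := by
  have hη (c : Fin n → ℝ) (i : Fin n) : η i (∑ j, c j • e j) = c i := by
    have := map_sum (hlin i).mk' (fun j => c j • e j) Finset.univ
    simp only [map_smul, IsLinearMap.mk'_apply, hd] at this
    simpa using this
  have hli : LinearIndependent ℝ e := by
    rw [Fintype.linearIndependent_iff]
    intro c hc i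
    rw [← hη c i, hc]
    exact (hlin i).map_zero
  let b := basisOfLinearIndependentOfCardEqFinrank' e hli (by simp [hV])
  have h1 : v = ∑ i, b.repr v i • e i := by
    conv_lhs => rw [← b.sum_repr v]
    simp [b]
  have h2 (i : Fin n) : η i v = b.repr v i := by
    conv_lhs => rw [h1]
    exact hη _ i
  simp only [h2]
  exact h1

end DualBasis

/-! ### Smooth functions, fields and forms -/

section Smoothness

variable {n : ℕ} {M : Type*} [TopologicalSpace M] [ChartedSpace (EuclideanSpace ℝ (Fin n)) M]

theorem contMDiffAt_clm_of_apply {F : Type*} [NormedAddCommGroup F] [NormedSpace ℝ F]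
    {g : M → EuclideanSpace ℝ (Fin n) →L[ℝ] F} {x : M}
    (h : ∀ v, ContMDiffAt (𝓡 n) 𝓘(ℝ, F) ∞ (fun y => g y v) x) :
    ContMDiffAt (𝓡 n) 𝓘(ℝ, EuclideanSpace ℝ (Fin n) →L[ℝ] F) ∞ g x := by
  let b := EuclideanSpace.basisFun (Fin n) ℝ
  have key : g = fun y => ∑ i,
      (ContinuousLinearMap.smulRightL ℝ _ _ (EuclideanSpace.proj i)) (g y (b i)) := by
    funext y
    ext v
    conv_lhs => rw [← b.sum_repr v]
    simp [b]
  rw [key]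
  exact contMDiffAt_finsetSum fun i _ =>
    (ContinuousLinearMap.contMDiff _).contMDiffAt.comp x (h _)

theorem contMDiffAt_det {m : ℕ} {A : M → Matrix (Fin m) (Fin m) ℝ} {x : M}
    (h : ∀ i j, ContMDiffAt (𝓡 n) 𝓘(ℝ) ∞ (fun y => A y i j) x) :
    ContMDiffAt (𝓡 n) 𝓘(ℝ) ∞ (fun y => (A y).det) x := by
  simp only [Matrix.det_apply']
  refine contMDiffAt_finsetSum fun σ _ => contMDiffAt_const.mul ?_
  exact contMDiffAt_finsetProd fun i _ => h _ _

theorem contMDiffAt_matrix_inv {m : ℕ} {A : M → Matrix (Fin m) (Fin m) ℝ} {x : M}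
    (h : ∀ i j, ContMDiffAt (𝓡 n) 𝓘(ℝ) ∞ (fun y => A y i j) x) (hx : (A x).det ≠ 0) (i j : Fin m) :
    ContMDiffAt (𝓡 n) 𝓘(ℝ) ∞ (fun y => (A y)⁻¹ i j) x := by
  simp only [Matrix.inv_def, Ring.inverse_eq_inv', Matrix.smul_apply, smul_eq_mul,
    Matrix.adjugate_apply]
  refine ((contMDiffAt_det h).inv₀ hx).mul (contMDiffAt_det fun k l => ?_)
  by_cases hk : k = j
  · subst hk
    simpa using contMDiffAt_const
  · simpa [Matrix.updateRow_ne hk] using h k l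

theorem finrank_tangentSpace (x : M) : Module.finrank ℝ (TangentSpace (𝓡 n) x) = n :=
  finrank_euclideanSpace_fin

/-- The instance of the model space, which type class search does not find under the name of the
tangent space. -/
instance finiteDimensional_tangentSpace (x : M) : FiniteDimensional ℝ (TangentSpace (𝓡 n) x) :=
  inferInstanceAs (FiniteDimensional ℝ (EuclideanSpace ℝ (Fin n)))

theorem tangent_eq_sum_of_dual {x : M} {η : Fin n → TangentSpace (𝓡 n) x →L[ℝ] ℝ}
    {e : Fin n → TangentSpace (𝓡 n) x} (hd : ∀ i j, η i (e j) = if i = j then 1 else 0)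
    (v : TangentSpace (𝓡 n) x) : v = ∑ i, η i v • e i :=
  eq_sum_of_dual (finrank_tangentSpace x) (fun i => (η i).isLinear) hd v

variable [IsManifold (𝓡 n) ∞ M]

theorem SmoothFormAt.apply {η : OneForm n M} {X : VField n M} {x : M} (hη : SmoothFormAt η x)
    (hX : SmoothFieldAt X x) : ContMDiffAt (𝓡 n) 𝓘(ℝ) ∞ (fun y => η y (X y)) x := by
  have := ContMDiffAt.clm_bundle_apply (E₂ := Bundle.Trivial M ℝ) hη hX
  rw [Bundle.contMDiffAt_section] at this
  exact this

/-- A section of a homomorphism bundle `Hom(TM, V)` is smooth if it maps smooth vector fields to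
smooth sections. -/
theorem contMDiffAt_hom_of_apply {F : Type*} [NormedAddCommGroup F] [NormedSpace ℝ F]
    {V : M → Type*} [TopologicalSpace (TotalSpace F V)]
    [∀ x, AddCommGroup (V x)] [∀ x, Module ℝ (V x)] [∀ x : M, TopologicalSpace (V x)]
    [∀ x, IsTopologicalAddGroup (V x)] [∀ x, ContinuousSMul ℝ (V x)]
    [FiberBundle F V] [VectorBundle ℝ F V]
    {A : (x : M) → TangentSpace (𝓡 n) x →L[ℝ] V x} {x : M}
    (h : ∀ X : VField n M, SmoothFieldAt X x → ContMDiffAt (𝓡 n) ((𝓡 n).prod 𝓘(ℝ, F)) ∞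
      (fun y => TotalSpace.mk' F (E := V) y (A y (X y))) x) :
    ContMDiffAt (𝓡 n) ((𝓡 n).prod 𝓘(ℝ, EuclideanSpace ℝ (Fin n) →L[ℝ] F)) ∞
      (fun y => TotalSpace.mk' (EuclideanSpace ℝ (Fin n) →L[ℝ] F)
        (E := fun y : M => TangentSpace (𝓡 n) y →L[ℝ] V y) y (A y)) x := by
  rw [contMDiffAt_hom_bundle]
  refine ⟨contMDiffAt_id, contMDiffAt_clm_of_apply fun v => ?_⟩
  set t := trivializationAt (EuclideanSpace ℝ (Fin n)) (TangentSpace (𝓡 n) : M → Type _) x with ht'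
  have ht : x ∈ t.baseSet := FiberBundle.mem_baseSet_trivializationAt' x
  set s := trivializationAt F V x with hs'
  have hs : x ∈ s.baseSet := FiberBundle.mem_baseSet_trivializationAt' x
  have hX : SmoothFieldAt (FiberBundle.extend (EuclideanSpace ℝ (Fin n)) (t.symm x v)) x :=
    FiberBundle.contMDiffAt_extend (𝓡 n) _ _
  have h1 := h _ hX
  rw [contMDiffAt_section] at h1
  refine h1.congr_of_eventuallyEq ?_
  filter_upwards [t.open_baseSet.mem_nhds ht, s.open_baseSet.mem_nhds hs] with y hy hy'
  rw [ContinuousLinearMap.inCoordinates_eq hy hy']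
  simp only [ContinuousLinearMap.comp_apply, FiberBundle.extend, ← ht', ← hs',
    ContinuousLinearEquiv.coe_coe, Trivialization.continuousLinearEquivAt_apply]
  congr 4
  rw [Trivialization.symm_continuousLinearEquivAt_eq, t.symmL_apply hy, t.mk_symm ht,
    t.apply_symm_apply]
  exact t.mem_target.2 ht

theorem SmoothFormAt.of_apply {η : OneForm n M} {x : M}
    (h : ∀ X : VField n M, SmoothFieldAt X x →
      ContMDiffAt (𝓡 n) 𝓘(ℝ) ∞ (fun y => η y (X y)) x) : SmoothFormAt η x := by
  refine contMDiffAt_hom_of_apply (V := Bundle.Trivial M ℝ) fun X hX => ?_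
  rw [Bundle.contMDiffAt_section]
  exact h X hX

theorem SmoothFieldAt.dirDeriv {X : VField n M} {f : M → ℝ} {x : M} (hX : SmoothFieldAt X x)
    (hf : ContMDiffAt (𝓡 n) 𝓘(ℝ) ∞ f x) : ContMDiffAt (𝓡 n) 𝓘(ℝ) ∞ (dirDeriv X f) x := by
  have h1 := ContMDiffAt.mfderiv_const hf (m := ∞) (by simp)
  have h2 := ContMDiffAt.clm_apply_of_inCoordinates (b₁ := id) (b₂ := f) h1 hX hf
  rw [contMDiffAt_totalSpace] at h2
  have h3 := h2.2
  simp at h3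
  exact h3

theorem smoothFieldAt_extend {x : M} (v : TangentSpace (𝓡 n) x) :
    SmoothFieldAt (FiberBundle.extend (EuclideanSpace ℝ (Fin n)) v) x :=
  FiberBundle.contMDiffAt_extend (𝓡 n) _ _

theorem SmoothFieldAt.smul {X : VField n M} {f : M → ℝ} {x : M}
    (hf : ContMDiffAt (𝓡 n) 𝓘(ℝ) ∞ f x) (hX : SmoothFieldAt X x) :
    SmoothFieldAt (fun y => f y • X y) x :=
  ContMDiffAt.smul_section hf hX

theorem SmoothFieldAt.sum {ι : Type*} {s : Finset ι} {X : ι → VField n M} {x : M}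
    (hX : ∀ i ∈ s, SmoothFieldAt (X i) x) : SmoothFieldAt (fun y => ∑ i ∈ s, X i y) x :=
  ContMDiffAt.sum_section hX

theorem SmoothFieldAt.sub {X Y : VField n M} {x : M}
    (hX : SmoothFieldAt X x) (hY : SmoothFieldAt Y x) : SmoothFieldAt (X - Y) x :=
  ContMDiffAt.sub_section hX hY

/-- The vector field `X` is differentiable at `x`, as a section of the tangent bundle. -/
abbrev MDiffFieldAt (X : VField n M) (x : M) : Prop :=
  MDifferentiableAt (𝓡 n) ((𝓡 n).prod 𝓘(ℝ, EuclideanSpace ℝ (Fin n)))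
    (fun y : M => TotalSpace.mk' (EuclideanSpace ℝ (Fin n))
      (E := (TangentSpace (𝓡 n) : M → Type _)) y (X y)) x

theorem SmoothFieldAt.mdiff {X : VField n M} {x : M} (hX : SmoothFieldAt X x) : MDiffFieldAt X x :=
  ContMDiffAt.mdifferentiableAt hX (by simp)

theorem SmoothFormAt.smul {η : OneForm n M} {f : M → ℝ} {x : M}
    (hf : ContMDiffAt (𝓡 n) 𝓘(ℝ) ∞ f x) (hη : SmoothFormAt η x) :
    SmoothFormAt (fun y => f y • η y) x :=
  .of_apply fun _ hX => hf.mul (hη.apply hX)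

theorem SmoothFormAt.finsetSum {ι : Type*} {s : Finset ι} {η : ι → OneForm n M} {x : M}
    (hη : ∀ i ∈ s, SmoothFormAt (η i) x) : SmoothFormAt (fun y => ∑ i ∈ s, η i y) x := by
  refine .of_apply fun X hX => ?_
  simp only [sum_apply]
  exact contMDiffAt_finsetSum fun i hi => (hη i hi).apply hX

theorem SmoothFormAt.congr {η η' : OneForm n M} {x : M} (hη : SmoothFormAt η x)
    (h : ∀ᶠ y in 𝓝 x, η' y = η y) : SmoothFormAt η' x :=
  ContMDiffAt.congr_of_eventuallyEq hη (h.mono fun y hy => by simp only [hy])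

/-- The frame dual to a smooth coframe is smooth. -/
theorem smoothFieldAt_of_dual {η : Fin n → OneForm n M} {e : Fin n → VField n M} {x : M}
    (hη : ∀ i, SmoothFormAt (η i) x)
    (hd : ∀ᶠ y in 𝓝 x, ∀ i j, η i y (e j y) = if i = j then 1 else 0) (j : Fin n) :
    SmoothFieldAt (e j) x := by
  -- Expand smooth extensions `f k` of the vectors `e k x` in the frame `e`: the matrix of
  -- coefficients is smooth and invertible near `x`, and its inverse expresses `e` through `f`.
  let f (k : Fin n) : VField n M := FiberBundle.extend (EuclideanSpace ℝ (Fin n)) (e k x)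
  have hf (k : Fin n) : SmoothFieldAt (f k) x := smoothFieldAt_extend _
  let A (y : M) : Matrix (Fin n) (Fin n) ℝ := fun i k => η i y (f k y)
  have hA (i k : Fin n) : ContMDiffAt (𝓡 n) 𝓘(ℝ) ∞ (fun y => A y i k) x := (hη i).apply (hf k)
  have hAx : A x = 1 := by
    ext i k
    simp [A, f, hd.self_of_nhds i k, Matrix.one_apply]
  have hdet : (A x).det ≠ 0 := by simp [hAx]
  have hne : ∀ᶠ y in 𝓝 x, (A y).det ≠ 0 :=
    (contMDiffAt_det hA).continuousAt.eventually_ne hdet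
  have key : SmoothFieldAt (fun y => ∑ k, (A y)⁻¹ k j • f k y) x :=
    .sum fun k _ => (hf k).smul (contMDiffAt_matrix_inv hA hdet k j)
  refine ContMDiffAt.congr_of_eventuallyEq key ?_
  filter_upwards [hd, hne] with y hy hne
  congr 1
  have h1 (k : Fin n) : f k y = ∑ i, A y i k • e i y := tangent_eq_sum_of_dual hy _
  have h2 : A y * (A y)⁻¹ = 1 := Matrix.mul_nonsing_inv _ (isUnit_iff_ne_zero.2 hne)
  simp only [h1, Finset.smul_sum, smul_smul]
  rw [Finset.sum_comm]
  simp only [← Finset.sum_smul, mul_comm ((A y)⁻¹ _ _), ← Matrix.mul_apply, h2, Matrix.one_apply]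
  simp

end Smoothness

/-! ### Symmetric covariant differentials and totally geodesic leaves -/

section Calculus

variable {n : ℕ} {M : Type*} [TopologicalSpace M] [ChartedSpace (EuclideanSpace ℝ (Fin n)) M]

theorem dirDeriv_congr {X : VField n M} {f g : M → ℝ} {x : M} (h : f =ᶠ[𝓝 x] g) :
    dirDeriv X f x = dirDeriv X g x := by
  simp only [dirDeriv, mvfderiv, h.mfderiv_eq]
  rfl

theorem dirDeriv_add {X : VField n M} {f g : M → ℝ} {x : M}
    (hf : MDifferentiableAt (𝓡 n) 𝓘(ℝ) f x) (hg : MDifferentiableAt (𝓡 n) 𝓘(ℝ) g x) :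
    dirDeriv X (fun y => f y + g y) x = dirDeriv X f x + dirDeriv X g x := by
  have := mvfderiv_add hf hg
  simp only [dirDeriv]
  exact congr($this (X x))

theorem dirDeriv_sub {X : VField n M} {f g : M → ℝ} {x : M}
    (hf : MDifferentiableAt (𝓡 n) 𝓘(ℝ) f x) (hg : MDifferentiableAt (𝓡 n) 𝓘(ℝ) g x) :
    dirDeriv X (fun y => f y - g y) x = dirDeriv X f x - dirDeriv X g x := by
  have := mvfderiv_sub hf hg
  simp only [dirDeriv]
  exact congr($this (X x))

theorem dirDeriv_neg {X : VField n M} {f : M → ℝ} {x : M} :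
    dirDeriv X (fun y => - f y) x = - dirDeriv X f x := by
  have := mvfderiv_neg (I := 𝓡 n) (g := f) (x := x)
  simp only [dirDeriv]
  exact congr($this (X x))

theorem dirDeriv_const {X : VField n M} {x : M} (c : ℝ) :
    dirDeriv X (fun _ => c) x = 0 := by
  have := mvfderiv_const (I := 𝓡 n) (x := x) c
  simp only [dirDeriv]
  exact congr($this (X x))

theorem dirDeriv_mul {X : VField n M} {f g : M → ℝ} {x : M}
    (hf : MDifferentiableAt (𝓡 n) 𝓘(ℝ) f x) (hg : MDifferentiableAt (𝓡 n) 𝓘(ℝ) g x) :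
    dirDeriv X (fun y => f y * g y) x = f x * dirDeriv X g x + dirDeriv X f x * g x := by
  have := congr($(mvfderiv_mul hf hg) (X x))
  simp only [dirDeriv]
  refine this.trans ?_
  simp [mul_comm]

theorem mdifferentiableAt_finsetSum {ι : Type*} {s : Finset ι} {f : ι → M → ℝ} {x : M}
    (hf : ∀ i ∈ s, MDifferentiableAt (𝓡 n) 𝓘(ℝ) (f i) x) :
    MDifferentiableAt (𝓡 n) 𝓘(ℝ) (fun y => ∑ i ∈ s, f i y) x := by
  classical
  induction s using Finset.induction_on with
  | empty => simpa using mdifferentiableAt_const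
  | insert a s ha ih =>
    simp only [Finset.sum_insert ha, Finset.mem_insert, forall_eq_or_imp] at hf ⊢
    exact hf.1.add (ih hf.2)

theorem dirDeriv_sum {ι : Type*} {s : Finset ι} {X : VField n M} {f : ι → M → ℝ} {x : M}
    (hf : ∀ i ∈ s, MDifferentiableAt (𝓡 n) 𝓘(ℝ) (f i) x) :
    dirDeriv X (fun y => ∑ i ∈ s, f i y) x = ∑ i ∈ s, dirDeriv X (f i) x := by
  classical
  induction s using Finset.induction_on with
  | empty => simpa using dirDeriv_const 0
  | insert a s ha ih =>
    simp only [Finset.sum_insert ha, Finset.mem_insert, forall_eq_or_imp] at hf ⊢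
    rw [dirDeriv_add hf.1 (mdifferentiableAt_finsetSum hf.2), ih hf.2]

/-- Logarithmic differentiation, also where `f` is negative: `Real.log` is the logarithm of the
absolute value. -/
theorem dirDeriv_log {X : VField n M} {f : M → ℝ} {x : M}
    (hf : MDifferentiableAt (𝓡 n) 𝓘(ℝ) f x) (h0 : f x ≠ 0) :
    dirDeriv X (fun y => Real.log (f y)) x = dirDeriv X f x / f x := by
  have h := (Real.hasDerivAt_log h0).hasFDerivAt.hasMFDerivAt.comp x hf.hasMFDerivAt
  have h2 : mfderiv (𝓡 n) 𝓘(ℝ) (fun y => Real.log (f y)) x = _ := h.mfderiv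
  simp only [dirDeriv, mvfderiv, h2]
  exact (ContinuousLinearMap.toSpanSingleton_apply ℝ (f x)⁻¹
    (mfderiv (𝓡 n) 𝓘(ℝ) f x (X x) : ℝ)).trans (div_eq_mul_inv _ _).symm

/-- The type of covariant derivatives of vector fields, without any rules: `cov Y x v` stands for
the derivative of `Y` in the direction `v` at `x`. Being total, it also serves for connections that
are defined on an open set only. -/
abbrev Cov (n : ℕ) (M : Type*) [TopologicalSpace M]
    [ChartedSpace (EuclideanSpace ℝ (Fin n)) M] : Type _ :=
  VField n M → (x : M) → TangentSpace (𝓡 n) x →L[ℝ] TangentSpace (𝓡 n) x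

/-- The symmetric covariant differential of `η`, as in `symCovDiff`, for the operator `cov`. -/
def covSym (cov : Cov n M) (η : OneForm n M) (X Y : VField n M) (x : M) : ℝ :=
  ((dirDeriv X (fun y => η y (Y y)) x - η x (cov Y x (X x)))
    + (dirDeriv Y (fun y => η y (X y)) x - η x (cov X x (Y x)))) / 2

theorem covSym_comm (cov : Cov n M) (η : OneForm n M) (X Y : VField n M) (x : M) :
    covSym cov η X Y x = covSym cov η Y X x := by
  simp only [covSym, add_comm]

theorem covSym_congr {cov : Cov n M} {η η' : OneForm n M} {X Y : VField n M} {x : M}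
    (h : ∀ᶠ y in 𝓝 x, η y = η' y) : covSym cov η X Y x = covSym cov η' X Y x := by
  have h1 (Z : VField n M) : (fun y => η y (Z y)) =ᶠ[𝓝 x] fun y => η' y (Z y) :=
    h.mono fun y hy => by simp only [hy]
  simp only [covSym, dirDeriv_congr (h1 _), h.self_of_nhds]

theorem covSym_neg {cov : Cov n M} {η : OneForm n M} {X Y : VField n M} {x : M} :
    covSym cov (-η) X Y x = - covSym cov η X Y x := by
  simp only [covSym, Pi.neg_apply, neg_apply, dirDeriv_neg]
  ring

theorem exists_apply_eq_one {x : M} {φ : TangentSpace (𝓡 n) x →L[ℝ] ℝ} (h : φ ≠ 0) :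
    ∃ z, φ z = 1 := by
  obtain ⟨z, hz⟩ := DFunLike.ne_iff.1 h
  exact ⟨(φ z)⁻¹ • z, by simpa using inv_mul_cancel₀ hz⟩

variable [IsManifold (𝓡 n) ∞ M]

theorem SmoothFormAt.mdiff_apply {η : OneForm n M} {X : VField n M} {x : M}
    (hη : SmoothFormAt η x) (hX : MDiffFieldAt X x) :
    MDifferentiableAt (𝓡 n) 𝓘(ℝ) (fun y => η y (X y)) x := by
  have := MDifferentiableAt.clm_bundle_apply (E₂ := Bundle.Trivial M ℝ)
    (ContMDiffAt.mdifferentiableAt hη (by simp)) hX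
  rw [mdifferentiableAt_section] at this
  exact this

/-- The operator `cov` obeys at `x` the rules of a torsion-free connection: additivity, the Leibniz
rule, and `∇_X Y - ∇_Y X = [X, Y]`, for fields differentiable at `x`. -/
structure IsTorsionFreeAt (cov : Cov n M) (x : M) : Prop where
  isCov : IsCovariantDerivativeOn (EuclideanSpace ℝ (Fin n)) cov {x}
  torsion : ∀ X Y : VField n M, MDiffFieldAt X x → MDiffFieldAt Y x →
    cov Y x (X x) - cov X x (Y x) = VectorField.mlieBracket (𝓡 n) X Y x

theorem TorsionFreeConnection.isTorsionFreeAt (D : TorsionFreeConnection n M) (x : M) :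
    IsTorsionFreeAt D.cov x where
  isCov := D.cov.isCovariantDerivativeOn
  torsion X Y hX hY := by
    exact (D.cov.torsion_eq_zero_iff.1 D.torsion_eq_zero) hX hY

theorem symCovDiff_eq (D : TorsionFreeConnection n M) (η : OneForm n M) (X Y : VField n M) (x : M) :
    symCovDiff D η X Y x = covSym D.cov η X Y x := rfl

theorem covSym_tensorial {cov : Cov n M} {x : M} (h : IsTorsionFreeAt cov x) {η : OneForm n M}
    (hη : SmoothFormAt η x) (Y : VField n M) :
    TensorialAt (𝓡 n) (EuclideanSpace ℝ (Fin n)) (fun X => covSym cov η X Y x) x where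
  smul {f X} hf hX := by
    have h1 := h.isCov.leibniz hX hf rfl
    have h2 : dirDeriv Y (fun y => η y ((f • X) y)) x = f x * dirDeriv Y (fun y => η y (X y)) x
        + dirDeriv Y f x * η x (X x) := by
      rw [← dirDeriv_mul hf (hη.mdiff_apply hX)]
      simp
    have h3 : dirDeriv (f • X) (fun y => η y (Y y)) x =
        f x * dirDeriv X (fun y => η y (Y y)) x := by
      simp [dirDeriv]
    unfold covSym
    rw [h1, h2, h3]
    simp only [Pi.smul_apply', map_smul, add_apply, smul_apply, map_add,
      ContinuousLinearMap.smulRight_apply, smul_eq_mul]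
    simp only [dirDeriv]
    ring
  add {X X'} hX hX' := by
    have h1 := h.isCov.add hX hX' rfl
    have h2 : dirDeriv Y (fun y => η y ((X + X') y)) x = dirDeriv Y (fun y => η y (X y)) x
        + dirDeriv Y (fun y => η y (X' y)) x := by
      rw [← dirDeriv_add (hη.mdiff_apply hX) (hη.mdiff_apply hX')]
      simp
    have h3 : dirDeriv (X + X') (fun y => η y (Y y)) x = dirDeriv X (fun y => η y (Y y)) x
        + dirDeriv X' (fun y => η y (Y y)) x := by
      simp [dirDeriv]
    unfold covSym
    rw [h1, h2, h3]
    simp only [Pi.add_apply, map_add, add_apply]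
    ring

/-- The symmetric covariant differential at a point, as a bilinear form on the tangent space: by
`covSym_tensorial` it depends on the values of the two fields at that point only. -/
def symForm {cov : Cov n M} {x : M} (h : IsTorsionFreeAt cov x) {η : OneForm n M}
    (hη : SmoothFormAt η x) : TangentSpace (𝓡 n) x →L[ℝ] TangentSpace (𝓡 n) x →L[ℝ] ℝ :=
  TensorialAt.mkHom₂ (fun X Y => covSym cov η X Y x) x (fun Y _ => covSym_tensorial h hη Y)
    (fun X _ => by
      have := covSym_tensorial h hη X
      simp only [covSym_comm cov η _ X] at this
      exact this)

theorem symForm_apply {cov : Cov n M} {x : M} (h : IsTorsionFreeAt cov x) {η : OneForm n M}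
    (hη : SmoothFormAt η x) {X Y : VField n M} (hX : MDiffFieldAt X x) (hY : MDiffFieldAt Y x) :
    symForm h hη (X x) (Y x) = covSym cov η X Y x :=
  TensorialAt.mkHom₂_apply _ _ hX hY

theorem symForm_comm {cov : Cov n M} {x : M} (h : IsTorsionFreeAt cov x) {η : OneForm n M}
    (hη : SmoothFormAt η x) (u v : TangentSpace (𝓡 n) x) :
    symForm h hη u v = symForm h hη v u :=
  covSym_comm _ _ _ _ _

/-- The Leibniz rule for the symmetric covariant differential of a combination of one-forms. -/
theorem covSym_sum_smul {cov : Cov n M} {ι : Type*} {s : Finset ι} {f : ι → M → ℝ}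
    {η : ι → OneForm n M} {X Y : VField n M} {x : M}
    (hf : ∀ i ∈ s, MDifferentiableAt (𝓡 n) 𝓘(ℝ) (f i) x) (hη : ∀ i ∈ s, SmoothFormAt (η i) x)
    (hX : MDiffFieldAt X x) (hY : MDiffFieldAt Y x) :
    covSym cov (fun y => ∑ i ∈ s, f i y • η i y) X Y x =
      ∑ i ∈ s, (f i x * covSym cov (η i) X Y x
        + (dirDeriv X (f i) x * η i x (Y x) + dirDeriv Y (f i) x * η i x (X x)) / 2) := by
  have h1 {Z W : VField n M} (hW : MDiffFieldAt W x) :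
      dirDeriv Z (fun y => ∑ i ∈ s, f i y * η i y (W y)) x =
      ∑ i ∈ s,
        (f i x * dirDeriv Z (fun y => η i y (W y)) x + dirDeriv Z (f i) x * η i x (W x)) := by
    rw [dirDeriv_sum (f := fun i y => f i y * η i y (W y))
      fun i hi => (hf i hi).mul ((hη i hi).mdiff_apply hW)]
    exact Finset.sum_congr rfl fun i hi => dirDeriv_mul (hf i hi) ((hη i hi).mdiff_apply hW)
  simp only [covSym, sum_apply, smul_apply, smul_eq_mul]
  rw [h1 hX, h1 hY, ← Finset.sum_sub_distrib, ← Finset.sum_sub_distrib, ← Finset.sum_add_distrib,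
    Finset.sum_div]
  exact Finset.sum_congr rfl fun i _ => by ring

/-- A tangent vector in the kernel of a one-form extends to a field tangent to its kernel. -/
theorem exists_smoothField_ker {η : OneForm n M} {x : M} (hη : SmoothFormAt η x) (h0 : η x ≠ 0)
    {u : TangentSpace (𝓡 n) x} (hu : η x u = 0) :
    ∃ X : VField n M, SmoothFieldAt X x ∧ X x = u ∧ ∀ᶠ y in 𝓝 x, η y (X y) = 0 := by
  obtain ⟨z, hz⟩ := exists_apply_eq_one h0
  let Z : VField n M := FiberBundle.extend (EuclideanSpace ℝ (Fin n)) z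
  let Y : VField n M := FiberBundle.extend (EuclideanSpace ℝ (Fin n)) u
  have hZ : SmoothFieldAt Z x := smoothFieldAt_extend z
  have hY : SmoothFieldAt Y x := smoothFieldAt_extend u
  have hZx : η x (Z x) = 1 := by simp [Z, hz]
  have hYx : Y x = u := by simp [Y]
  have hne : ∀ᶠ y in 𝓝 x, η y (Z y) ≠ 0 :=
    (hη.apply hZ).continuousAt.eventually_ne (by simp [hZx])
  refine ⟨Y - fun y => (η y (Y y) / η y (Z y)) • Z y,
    hY.sub (hZ.smul ((hη.apply hY).div₀ (hη.apply hZ) (by simp [hZx]))), by simp [hYx, hu], ?_⟩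
  filter_upwards [hne] with y hy
  simp [hy]

/-- `X` and `Y` being tangent to the kernel of an integrable form, so is their bracket. -/
theorem apply_mlieBracket_eq_zero {η : OneForm n M} {x : M} (h0 : η x ≠ 0)
    (hint : ∀ X Y Z : VField n M, SmoothFieldAt X x → SmoothFieldAt Y x → SmoothFieldAt Z x →
      wedgeExtD η X Y Z x = 0) {X Y : VField n M} (hX : SmoothFieldAt X x)
    (hY : SmoothFieldAt Y x) (hX0 : ∀ᶠ y in 𝓝 x, η y (X y) = 0)
    (hY0 : ∀ᶠ y in 𝓝 x, η y (Y y) = 0) : η x (VectorField.mlieBracket (𝓡 n) X Y x) = 0 := by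
  obtain ⟨z, hz⟩ := exists_apply_eq_one h0
  have := hint X Y _ hX hY (smoothFieldAt_extend z)
  simpa [wedgeExtD, extD, hX0.self_of_nhds, hY0.self_of_nhds, hz,
    dirDeriv_congr (X := X) (f := fun y => η y (Y y)) (g := fun _ => 0) hY0,
    dirDeriv_congr (X := Y) (f := fun y => η y (X y)) (g := fun _ => 0) hX0, dirDeriv_const]
    using this

/-- The leaves of an integrable form are totally geodesic if and only if its symmetric covariant
differential vanishes on its kernel. -/
theorem geodesic_iff_symForm {cov : Cov n M} {x : M} (h : IsTorsionFreeAt cov x) {η : OneForm n M}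
    (hη : SmoothFormAt η x) (h0 : η x ≠ 0)
    (hint : ∀ X Y Z : VField n M, SmoothFieldAt X x → SmoothFieldAt Y x → SmoothFieldAt Z x →
      wedgeExtD η X Y Z x = 0) :
    (∀ X Y : VField n M, SmoothFieldAt X x → SmoothFieldAt Y x → (∀ᶠ y in 𝓝 x, η y (X y) = 0) →
      (∀ᶠ y in 𝓝 x, η y (Y y) = 0) → η x (cov Y x (X x)) = 0) ↔
    ∀ u v, η x u = 0 → η x v = 0 → symForm h hη u v = 0 := by
  have key {X Y : VField n M} (hX : SmoothFieldAt X x) (hY : SmoothFieldAt Y x)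
      (hX0 : ∀ᶠ y in 𝓝 x, η y (X y) = 0) (hY0 : ∀ᶠ y in 𝓝 x, η y (Y y) = 0) :
      symForm h hη (X x) (Y x) = - η x (cov Y x (X x)) := by
    have h1 := apply_mlieBracket_eq_zero h0 hint hX hY hX0 hY0
    rw [← h.torsion X Y hX.mdiff hY.mdiff, map_sub] at h1
    rw [symForm_apply h hη hX.mdiff hY.mdiff, covSym,
      dirDeriv_congr (X := X) (f := fun y => η y (Y y)) (g := fun _ => 0) hY0,
      dirDeriv_congr (X := Y) (f := fun y => η y (X y)) (g := fun _ => 0) hX0, dirDeriv_const,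
      dirDeriv_const]
    linarith
  constructor
  · intro hg u v hu hv
    obtain ⟨X, hX, rfl, hX0⟩ := exists_smoothField_ker hη h0 hu
    obtain ⟨Y, hY, rfl, hY0⟩ := exists_smoothField_ker hη h0 hv
    rw [key hX hY hX0 hY0, hg X Y hX hY hX0 hY0, neg_zero]
  · intro hq X Y hX hY hX0 hY0
    have := key hX hY hX0 hY0
    rw [hq _ _ hX0.self_of_nhds hY0.self_of_nhds] at this
    linarith

end Calculus

/-! ### Symmetric products of covectors and the coefficients `s_ij` -/

section SymmetricProducts

variable {V : Type*} [AddCommGroup V] [Module ℝ V] [TopologicalSpace V]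

/-- The symmetric product of two covectors, as in `symProd`. -/
def symMul (θ η : V →L[ℝ] ℝ) (u v : V) : ℝ := (θ u * η v + θ v * η u) / 2

/-- A symmetric bilinear form that vanishes on the kernel of a covector is divisible by it. -/
theorem exists_eq_symMul {Q : V →L[ℝ] V →L[ℝ] ℝ} (hQ : ∀ u v, Q u v = Q v u) {η : V →L[ℝ] ℝ}
    {z : V} (hz : η z = 1) (h : ∀ u v, η u = 0 → η v = 0 → Q u v = 0) :
    ∃ θ : V →L[ℝ] ℝ, ∀ u v, Q u v = symMul θ η u v := by
  refine ⟨(2 : ℝ) • Q z - Q z z • η, fun u v => ?_⟩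
  have := h (u - η u • z) (v - η v • z) (by simp [hz]) (by simp [hz])
  simp only [map_sub, map_smul, sub_apply, smul_apply, smul_eq_mul] at this
  simp only [symMul, sub_apply, smul_apply, smul_eq_mul]
  rw [hQ u z] at this
  linarith

/-- A covector is determined by its symmetric products with all covectors, provided that these
separate the vectors from zero. -/
theorem eq_of_symMul_eq {ρ ρ' : V →L[ℝ] ℝ}
    (hsep : ∀ u : V, u ≠ 0 → ∃ η : V →L[ℝ] ℝ, η u = 1)
    (h : ∀ (η : V →L[ℝ] ℝ) u v, symMul ρ η u v = symMul ρ' η u v) : ρ = ρ' := by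
  ext u
  by_cases hu : u = 0
  · simp [hu]
  · obtain ⟨η, hη⟩ := hsep u hu
    have := h η u u
    simp only [symMul, hη] at this
    linarith

theorem sum_mul_eq_zero_of_antisymm {n : ℕ} {d X : Fin n → Fin n → ℝ}
    (hd : ∀ i j, d i j = - d j i) (hX : ∀ i j, X i j = X j i) :
    ∑ i, ∑ j, d i j * X i j = 0 := by
  have h : ∑ i, ∑ j, d i j * X i j = - ∑ i, ∑ j, d i j * X i j := by
    conv_lhs => rw [Finset.sum_comm]
    simp only [← Finset.sum_neg_distrib]
    refine Finset.sum_congr rfl fun i _ => Finset.sum_congr rfl fun j _ => ?_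
    rw [hd j i, hX j i]
    ring
  linarith

/-- The coefficients `s_ij` at a point, written with the differentials `α i` of the functions
`a i`: the differential of `log |a j / a i|` is `α j / a j - α i / a i`. -/
def sVal {n : ℕ} (e : Fin n → V) (a : Fin n → ℝ) (α : Fin n → V →L[ℝ] ℝ) (i j : Fin n) : ℝ :=
  if i = j then 0 else
    (a i - a j)⁻¹ * (a i * (α j (e j) / a j - α i (e j) / a i)
      - a j * (α j (e i) / a j - α i (e i) / a i))

variable {n : ℕ} {η : Fin n → V →L[ℝ] ℝ} {e : Fin n → V} {a : Fin n → ℝ}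
  {α : Fin n → V →L[ℝ] ℝ}

theorem sVal_self (i : Fin n) : sVal e a α i i = 0 := by simp [sVal]

theorem sVal_antisymm (i j : Fin n) : sVal e a α i j = - sVal e a α j i := by
  by_cases h : i = j
  · subst h
    simp [sVal]
  · have h' : (a j - a i)⁻¹ = - (a i - a j)⁻¹ := by rw [← inv_neg, neg_sub]
    simp only [sVal, h, Ne.symm h, if_false, h']
    ring

/-- The equation that determines `s_ij`. -/
theorem sVal_eq (ha : ∀ i, a i ≠ 0) (hne : ∀ i j, i ≠ j → a i ≠ a j) (i j : Fin n) :
    a i * sVal e a α i j + a j * sVal e a α j i + α i (e j) + α j (e i) =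
      a i * (α j (e j) / a j) + a j * (α i (e i) / a i) := by
  by_cases h : i = j
  · subst h
    simp only [sVal_self]
    field_simp [ha i]
    ring
  · rw [sVal_antisymm j i]
    have h1 := ha i
    have h2 := ha j
    have h3 : a i - a j ≠ 0 := sub_ne_zero.2 (hne i j h)
    simp only [sVal, h, if_false]
    field_simp
    ring

/-- If the forms `θ + ∑ j, s_ij η_j` are used as factors, the sum of the symmetric products is
divisible by the sum of the `η_i`. -/
theorem sum_symMul_eq (θ : V →L[ℝ] ℝ) (u v : V) :
    ∑ i, symMul (θ + ∑ j, sVal e a α i j • η j) (η i) u v = symMul θ (∑ i, η i) u v := by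
  have h := sum_mul_eq_zero_of_antisymm (d := sVal e a α)
    (X := fun i j => η j u * η i v + η j v * η i u) sVal_antisymm (fun i j => by ring)
  simp only [symMul, add_apply, sum_apply, smul_apply, smul_eq_mul]
  rw [← sub_eq_zero, ← mul_right_inj' (two_ne_zero (α := ℝ)), mul_zero, ← h, mul_sub,
    Finset.mul_sum, Finset.mul_sum, Finset.mul_sum, mul_div_cancel₀ _ two_ne_zero,
    ← Finset.sum_add_distrib, ← Finset.sum_sub_distrib]
  refine Finset.sum_congr rfl fun i _ => ?_
  simp only [mul_add, Finset.sum_add_distrib, ← mul_assoc, ← Finset.sum_mul]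
  ring

/-- With the same factors, the sum of the `a_i (θ_i · η_i) + α_i · η_i`, which is the symmetric
covariant differential of the sum of the `a_i η_i`, vanishes on the kernel of that sum. -/
theorem sum_symMul_vanish (hdual : ∀ u : V, u = ∑ j, η j u • e j) (ha : ∀ i, a i ≠ 0)
    (hne : ∀ i j, i ≠ j → a i ≠ a j) (θ : V →L[ℝ] ℝ) {u v : V} (hu : ∑ i, a i * η i u = 0)
    (hv : ∑ i, a i * η i v = 0) :
    ∑ i, (a i * symMul (θ + ∑ j, sVal e a α i j • η j) (η i) u v + symMul (α i) (η i) u v) = 0 := by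
  have h := sum_mul_eq_zero_of_antisymm
    (d := fun i j => a i * sVal e a α i j + α i (e j) - a i * (α j (e j) / a j))
    (X := fun i j => η j u * η i v + η j v * η i u)
    (fun i j => by linarith [sVal_eq (e := e) (α := α) ha hne i j]) (fun i j => by ring)
  have hα (i : Fin n) (w : V) : α i w = ∑ j, α i (e j) * η j w := by
    conv_lhs => rw [hdual w]
    simp [mul_comm]
  -- this and `h3` concern the terms that are divisible by `∑ i, a i * η i`
  have h2 : ∑ i, a i * ∑ j, (α j (e j) / a j) * (η j u * η i v + η j v * η i u) = 0 := by
    have : ∀ i, a i * ∑ j, (α j (e j) / a j) * (η j u * η i v + η j v * η i u) =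
        (a i * η i v) * (∑ j, α j (e j) / a j * η j u)
          + (a i * η i u) * ∑ j, α j (e j) / a j * η j v := fun i => by
      simp only [Finset.mul_sum, ← Finset.sum_add_distrib]
      exact Finset.sum_congr rfl fun j _ => by ring
    simp only [this, Finset.sum_add_distrib, ← Finset.sum_mul, hu, hv, zero_mul, add_zero]
  have h3 : ∑ i, a i * (θ u * η i v + θ v * η i u) = 0 := by
    have : ∀ i, a i * (θ u * η i v + θ v * η i u) = (a i * η i v) * θ u + (a i * η i u) * θ v :=
      fun i => by ring
    simp only [this, Finset.sum_add_distrib, ← Finset.sum_mul, hu, hv, zero_mul, add_zero]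
  have hX (i : Fin n) (c : Fin n → ℝ) : ∑ j, c j * (η j u * η i v + η j v * η i u) =
      (∑ j, c j * η j u) * η i v + (∑ j, c j * η j v) * η i u := by
    simp only [Finset.sum_mul, ← Finset.sum_add_distrib]
    exact Finset.sum_congr rfl fun j _ => by ring
  have hd (i : Fin n) (w : V) :
      ∑ j, (a i * sVal e a α i j + α i (e j) - a i * (α j (e j) / a j)) * η j w =
      a i * ∑ j, sVal e a α i j * η j w + α i w - a i * ∑ j, α j (e j) / a j * η j w := by
    simp only [hα i w, Finset.mul_sum, ← Finset.sum_add_distrib, ← Finset.sum_sub_distrib]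
    exact Finset.sum_congr rfl fun j _ => by ring
  have hi (i : Fin n) :
      a i * symMul (θ + ∑ j, sVal e a α i j • η j) (η i) u v + symMul (α i) (η i) u v =
      ((∑ j, (a i * sVal e a α i j + α i (e j) - a i * (α j (e j) / a j)) *
        (η j u * η i v + η j v * η i u)) +
      a i * ∑ j, (α j (e j) / a j) * (η j u * η i v + η j v * η i u) +
      a i * (θ u * η i v + θ v * η i u)) / 2 := by
    rw [hX, hX, hd, hd]
    simp only [symMul, add_apply, sum_apply, smul_apply, smul_eq_mul]
    ring
  rw [Finset.sum_congr rfl fun i _ => hi i, ← Finset.sum_div, Finset.sum_add_distrib,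
    Finset.sum_add_distrib, h, h2, h3]
  simp

/-- If symmetric forms `Q_i` are divisible by `η_i`, their sum by `∑ η_i`, and
`∑ (a_i Q_i + α_i · η_i)` by `∑ a_i η_i`, then they are of the form `Q_i = θ_i · η_i` with
`θ_i = θ + ∑ s_ij η_j`. -/
theorem eq_symMul_of_vanish (hd : ∀ i j, η i (e j) = if i = j then 1 else 0)
    (hdual : ∀ u : V, u = ∑ j, η j u • e j) (ha : ∀ i, a i ≠ 0)
    (hne : ∀ i j, i ≠ j → a i ≠ a j) {Q : Fin n → V →L[ℝ] V →L[ℝ] ℝ}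
    (hQ : ∀ i u v, Q i u v = Q i v u)
    (h1 : ∀ i u v, η i u = 0 → η i v = 0 → Q i u v = 0)
    (h2 : ∀ u, ∑ i, η i u = 0 → ∑ i, Q i u u = 0)
    (h3 : ∀ u, ∑ i, a i * η i u = 0 → ∑ i, (a i * Q i u u + α i u * η i u) = 0)
    (i : Fin n) (u v : V) :
    Q i u v = symMul (∑ j, Q j (e j) (e j) • η j + ∑ j, sVal e a α i j • η j) (η i) u v := by
  choose θ hθ using fun i => exists_eq_symMul (hQ i) (η := η i) (z := e i) (by simp [hd]) (h1 i)
  have hdiag (i : Fin n) : Q i (e i) (e i) = θ i (e i) := by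
    rw [hθ]
    simp [symMul, hd]
  have hdu (w : V) (k : Fin n) : Q k w w = θ k w * η k w := by
    rw [hθ, symMul]
    ring
  -- the value of `θ i` on `e j`, from the vectors `e i - e j` and `a j • e i - a i • e j`
  have key (i j : Fin n) : θ i (e j) = θ j (e j) + sVal e a α i j := by
    by_cases hij : i = j
    · subst hij
      simp [sVal_self]
    · have hsum (w : V) (F : Fin n → ℝ) (p q : ℝ) (hw : w = p • e i + q • e j) :
          ∑ k, F k * η k w = F i * p + F j * q := by
        subst hw
        simp only [map_add, map_smul, hd, smul_eq_mul, mul_add, Finset.sum_add_distrib]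
        simp
      have k2 := h2 ((1 : ℝ) • e i + (-1 : ℝ) • e j) (by
        simpa using hsum ((1 : ℝ) • e i + (-1 : ℝ) • e j) (fun _ => 1) _ _ rfl)
      have k3 := h3 (a j • e i + (-a i) • e j) (by
        rw [hsum _ a _ _ rfl]
        ring)
      simp only [hdu, ← mul_assoc, ← add_mul] at k2 k3
      rw [hsum _ _ _ _ rfl] at k2 k3
      simp only [map_add, map_smul, smul_eq_mul] at k2 k3
      have h0 := ha i
      have h0' := ha j
      have h0'' : a i - a j ≠ 0 := sub_ne_zero.2 (hne i j hij)
      have k4 := sVal_eq (e := e) (α := α) ha hne i j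
      rw [sVal_antisymm j i] at k4
      have hi : α i (e i) = a i * (α i (e i) / a i) := (mul_div_cancel₀ _ h0).symm
      have hj : α j (e j) = a j * (α j (e j) / a j) := (mul_div_cancel₀ _ h0').symm
      refine mul_left_cancel₀ (mul_ne_zero (mul_ne_zero h0 h0') h0'') ?_
      linear_combination (-1) * k3 + a i * a j ^ 2 * k2 - a i * a j * k4 + a j ^ 2 * hi
        + a i ^ 2 * hj
  have hθi : θ i = ∑ j, Q j (e j) (e j) • η j + ∑ j, sVal e a α i j • η j := by
    ext w
    conv_lhs => rw [hdual w]
    simp only [map_sum, map_smul, hdiag, smul_eq_mul, add_apply, sum_apply, smul_apply,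
      ← Finset.sum_add_distrib]
    refine Finset.sum_congr rfl fun j _ => ?_
    rw [key i j]
    ring
  rw [hθ, hθi]

end SymmetricProducts

/-! ### Webs in normal form -/

section NormalForm

variable {n : ℕ} {M : Type*} [TopologicalSpace M] [ChartedSpace (EuclideanSpace ℝ (Fin n)) M]

theorem eq_zero_of_linearIndependent {x : M} {φ : Fin n → TangentSpace (𝓡 n) x →L[ℝ] ℝ}
    (hφ : LinearIndependent ℝ φ) {w : TangentSpace (𝓡 n) x} (hw : ∀ k, φ k w = 0) : w = 0 := by
  let L : (TangentSpace (𝓡 n) x →L[ℝ] ℝ) →ₗ[ℝ] Module.Dual ℝ (TangentSpace (𝓡 n) x) :=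
    ContinuousLinearMap.coeLM ℝ
  have hli : LinearIndependent ℝ (fun k => L (φ k)) :=
    hφ.map' L (LinearMap.ker_eq_bot.2 ContinuousLinearMap.coe_injective)
  have hspan := hli.span_eq_top_of_card_eq_finrank' (by
    rw [Subspace.dual_finrank_eq, finrank_tangentSpace, Fintype.card_fin])
  rw [← Module.forall_dual_apply_eq_zero_iff ℝ]
  intro f
  have hf : f ∈ Submodule.span ℝ (Set.range fun k => L (φ k)) := hspan ▸ Submodule.mem_top
  induction hf using Submodule.span_induction with
  | mem f hf =>
    obtain ⟨k, rfl⟩ := hf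
    exact hw k
  | zero => rfl
  | add f g _ _ hf hg => simp [hf, hg]
  | smul c f _ hf => simp [hf]

variable [IsManifold (𝓡 n) ∞ M]

/-- The leaf through `x` of the `i`-th foliation is totally geodesic at `x`: the condition of
`Web.LeavesTotallyGeodesic`, for the operator `cov` and at one point. -/
def Web.GeodesicAt {d : ℕ} (W : Web n M d) (cov : Cov n M) (x : M) (i : Fin d) : Prop :=
  ∀ X Y : VField n M, SmoothFieldAt X x → SmoothFieldAt Y x →
    (∀ᶠ y in 𝓝 x, X y ∈ W.tangent i y) → (∀ᶠ y in 𝓝 x, Y y ∈ W.tangent i y) →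
      cov Y x (X x) ∈ W.tangent i x

theorem Web.isGeodesic_iff {d : ℕ} {W : Web n M d} {D : TorsionFreeConnection n M} :
    W.IsGeodesic D ↔ ∀ x i, W.GeodesicAt D.cov x i :=
  ⟨fun h x i => h i x, fun h i x => h x i⟩

theorem Web.IsGivenBy.geodesicAt_iff {d : ℕ} {W : Web n M d} {U : Set M}
    {η : Fin d → OneForm n M} (h : W.IsGivenBy U η) (hU : IsOpen U) {x : M} (hx : x ∈ U)
    {cov : Cov n M} (hc : IsTorsionFreeAt cov x) (i : Fin d) :
    W.GeodesicAt cov x i ↔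
      ∀ u v, η i x u = 0 → η i x v = 0 → symForm hc (h.1.smooth i x hx) u v = 0 := by
  rw [← geodesic_iff_symForm hc (h.1.smooth i x hx) (h.1.ne_zero i x hx) (h.1.integrable i x hx)]
  have h1 (X : VField n M) : (∀ᶠ y in 𝓝 x, X y ∈ W.tangent i y) ↔ ∀ᶠ y in 𝓝 x, η i y (X y) = 0 := by
    refine Filter.eventually_congr ?_
    filter_upwards [hU.mem_nhds hx] with y hy
    rw [h.2 i y hy]
    rfl
  simp only [Web.GeodesicAt, h1, h.2 i x hx]
  rfl

/-- Two ways to prescribe the symmetric covariant differential at `x`: on tangent vectors, and on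
smooth vector fields. -/
theorem symForm_eq_iff {cov : Cov n M} {x : M} (hc : IsTorsionFreeAt cov x) {η : OneForm n M}
    (hη : SmoothFormAt η x) (B : TangentSpace (𝓡 n) x → TangentSpace (𝓡 n) x → ℝ) :
    (∀ u v, symForm hc hη u v = B u v) ↔ ∀ X Y : VField n M, SmoothFieldAt X x →
      SmoothFieldAt Y x → covSym cov η X Y x = B (X x) (Y x) := by
  constructor
  · intro h X Y hX hY
    rw [← h, symForm_apply hc hη hX.mdiff hY.mdiff]
  · intro h u v
    have := h _ _ (smoothFieldAt_extend u) (smoothFieldAt_extend v)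
    rw [← symForm_apply hc hη (smoothFieldAt_extend u).mdiff (smoothFieldAt_extend v).mdiff] at this
    simpa using this

/-- Any further form of a web has nonzero coefficients with respect to the coframe formed by
`n` of its forms: otherwise `n` of the forms would vanish on a vector of the dual frame. -/
theorem IsWebOn.apply_ne_zero {U : Set M} {η : Fin (n + 2) → OneForm n M} (h : IsWebOn U η) {x : M}
    (hx : x ∈ U) {e : Fin n → TangentSpace (𝓡 n) x}
    (hd : ∀ i j : Fin n, η (Fin.castAdd 2 i) x (e j) = if i = j then 1 else 0) (l : Fin 2)
    (i : Fin n) : η (Fin.natAdd n l) x (e i) ≠ 0 := by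
  intro h0
  obtain ⟨σ, hσ⟩ : ∃ σ : Fin n ↪ Fin (n + 2),
      ∀ k, σ k = if k = i then Fin.natAdd n l else Fin.castAdd 2 k := by
    refine ⟨⟨fun k => if k = i then Fin.natAdd n l else Fin.castAdd 2 k, ?_⟩, fun _ => rfl⟩
    intro k m hkm
    simp only [Fin.ext_iff] at hkm ⊢
    split_ifs at hkm <;> simp at hkm <;> omega
  have h1 : e i = 0 := eq_zero_of_linearIndependent (h.independent x hx σ) fun k => by
    rw [hσ]
    by_cases hk : k = i
    · rw [if_pos hk, h0]
    · simp [hk, hd]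
  have h2 := hd i i
  simp [h1] at h2

/-- The covector `θ` for which the symmetric covariant differentials of the forms `η_i` are
`θ_i · η_i` with `θ_i = θ + ∑ j, s_ij η_j`, if there is one; its value on `e i` is `-η_i (∇ e_i)`
in the direction `e i`, because `s_ii = 0`. -/
def thetaForm (cov : Cov n M) (η : Fin (n + 2) → OneForm n M)
    (e : Fin n → VField n M) : OneForm n M := fun x =>
  ∑ i, (- η (Fin.castAdd 2 i) x (cov (e i) x (e i x))) • η (Fin.castAdd 2 i) x

namespace Web.IsNormalized

variable {W : Web n M (n + 2)} {U : Set M} {η : Fin (n + 2) → OneForm n M} {e : Fin n → VField n M}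
  {a : Fin n → M → ℝ} {x : M}

theorem smooth (h : W.IsNormalized U η e a) (hx : x ∈ U) (k : Fin (n + 2)) : SmoothFormAt (η k) x :=
  h.isGivenBy.1.smooth k x hx

theorem mem_nhds (h : W.IsNormalized U η e a) (hx : x ∈ U) : U ∈ 𝓝 x := h.isOpen.mem_nhds hx

theorem smooth_e (h : W.IsNormalized U η e a) (hx : x ∈ U) (j : Fin n) : SmoothFieldAt (e j) x :=
  smoothFieldAt_of_dual (fun i => h.smooth hx (Fin.castAdd 2 i))
    (Filter.eventually_of_mem (h.mem_nhds hx) fun y hy => h.dual y hy) j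

theorem eq_sum (h : W.IsNormalized U η e a) (hx : x ∈ U) (v : TangentSpace (𝓡 n) x) :
    v = ∑ i, η (Fin.castAdd 2 i) x v • e i x :=
  tangent_eq_sum_of_dual (h.dual x hx) v

theorem form_n (h : W.IsNormalized U η e a) (hx : x ∈ U) :
    η (Fin.natAdd n 0) x = - ∑ i, η (Fin.castAdd 2 i) x := by
  rw [eq_neg_iff_add_eq_zero, add_comm]
  exact h.sum_eq_zero x hx

theorem form_n_one (h : W.IsNormalized U η e a) (hx : x ∈ U) :
    η (Fin.natAdd n 1) x = - ∑ i, a i x • η (Fin.castAdd 2 i) x := by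
  rw [eq_neg_iff_add_eq_zero, add_comm]
  exact h.combination_eq_zero x hx

theorem a_eq (h : W.IsNormalized U η e a) (hx : x ∈ U) (i : Fin n) :
    a i x = - η (Fin.natAdd n 1) x (e i x) := by
  rw [h.form_n_one hx]
  simp [h.dual x hx]

theorem smooth_a (h : W.IsNormalized U η e a) (hx : x ∈ U) (i : Fin n) :
    ContMDiffAt (𝓡 n) 𝓘(ℝ) ∞ (a i) x :=
  (((h.smooth hx _).apply (h.smooth_e hx i)).neg).congr_of_eventuallyEq
    (Filter.eventually_of_mem (h.mem_nhds hx) fun _ hy => h.a_eq hy i)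

theorem a_ne_zero (h : W.IsNormalized U η e a) (hx : x ∈ U) (i : Fin n) : a i x ≠ 0 := by
  rw [h.a_eq hx, neg_ne_zero]
  exact h.isGivenBy.1.apply_ne_zero hx (h.dual x hx) 1 i

theorem a_ne (h : W.IsNormalized U η e a) (hx : x ∈ U) (i j : Fin n) (hij : i ≠ j) :
    a i x ≠ a j x := by
  -- otherwise the forms `η_k`, `k ≠ i, j`, `η_{n+1}` and `η_{n+2}` all vanish on `e i - e j`
  intro h0
  obtain ⟨σ, hσ⟩ : ∃ σ : Fin n ↪ Fin (n + 2), ∀ k, σ k = if k = i then Fin.natAdd n 0 else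
      if k = j then Fin.natAdd n 1 else Fin.castAdd 2 k := by
    refine ⟨⟨fun k => if k = i then Fin.natAdd n 0 else
      if k = j then Fin.natAdd n 1 else Fin.castAdd 2 k, ?_⟩, fun _ => rfl⟩
    intro k l hkl
    simp only [Fin.ext_iff] at hkl ⊢
    split_ifs at hkl <;> simp at hkl <;> omega
  have h1 := eq_zero_of_linearIndependent (h.isGivenBy.1.independent x hx σ)
    (w := e i x - e j x) fun k => by
      rw [hσ]
      by_cases hk : k = i
      · rw [if_pos hk]
        simp [h.form_n hx, h.dual x hx]
      · by_cases hk' : k = j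
        · have h1 := h.a_eq hx i
          have h2 := h.a_eq hx j
          rw [if_neg hk, if_pos hk', map_sub]
          linarith
        · simp [hk, hk', h.dual x hx]
  have h2 := h.dual x hx i i
  rw [sub_eq_zero.1 h1, h.dual x hx i j] at h2
  simp [hij] at h2

/-- At a point, `s_ij` is a function of the frame, the `a i`, and their differentials; the junk
values of `Real.log` and of division do not occur because the `a i` do not vanish. -/
theorem sCoeff_eq (h : W.IsNormalized U η e a) (hx : x ∈ U) (i j : Fin n) :
    sCoeff e a i j x =
      sVal (fun k => e k x) (fun k => a k x) (fun k => mvfderiv (𝓡 n) (a k) x) i j := by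
  have hm (k : Fin n) := (h.smooth_a hx k).mdifferentiableAt (by simp)
  have hlog {k : Fin n} : MDifferentiableAt (𝓡 n) 𝓘(ℝ) (fun y => Real.log (a k y)) x :=
    ((Real.differentiableAt_log (h.a_ne_zero hx k)).mdifferentiableAt).comp x (hm k)
  have key (X : VField n M) : dirDeriv X (fun y => Real.log (a j y / a i y)) x =
      mvfderiv (𝓡 n) (a j) x (X x) / a j x - mvfderiv (𝓡 n) (a i) x (X x) / a i x := by
    have h1 : (fun y => Real.log (a j y / a i y)) =ᶠ[𝓝 x]
        fun y => Real.log (a j y) - Real.log (a i y) :=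
      Filter.eventually_of_mem (h.mem_nhds hx) fun y hy =>
        Real.log_div (h.a_ne_zero hy j) (h.a_ne_zero hy i)
    rw [dirDeriv_congr h1, dirDeriv_sub hlog hlog, dirDeriv_log (hm j) (h.a_ne_zero hx j),
      dirDeriv_log (hm i) (h.a_ne_zero hx i)]
    rfl
  simp only [sCoeff, sVal, key]

theorem smooth_sCoeff (h : W.IsNormalized U η e a) (hx : x ∈ U) (i j : Fin n) :
    ContMDiffAt (𝓡 n) 𝓘(ℝ) ∞ (sCoeff e a i j) x := by
  by_cases hij : i = j
  · have : sCoeff e a i j = fun _ => 0 := by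
      funext y
      simp [sCoeff, hij]
    rw [this]
    exact contMDiffAt_const
  · have h1 : ContMDiffAt (𝓡 n) 𝓘(ℝ) ∞ (fun y => Real.log (a j y / a i y)) x :=
      (Real.contDiffAt_log.2
        (div_ne_zero (h.a_ne_zero hx j) (h.a_ne_zero hx i))).contMDiffAt.comp x
        ((h.smooth_a hx j).div₀ (h.smooth_a hx i) (h.a_ne_zero hx i))
    have h2 : sCoeff e a i j = fun x => (a i x - a j x)⁻¹ *
      (a i x * dirDeriv (e j) (fun y => Real.log (a j y / a i y)) x
        - a j x * dirDeriv (e i) (fun y => Real.log (a j y / a i y)) x) := by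
      funext y
      simp [sCoeff, hij]
    rw [h2]
    exact (((h.smooth_a hx i).sub (h.smooth_a hx j)).inv₀ (sub_ne_zero.2 (h.a_ne hx i j hij))).mul
      (((h.smooth_a hx i).mul ((h.smooth_e hx j).dirDeriv h1)).sub
        ((h.smooth_a hx j).mul ((h.smooth_e hx i).dirDeriv h1)))

theorem covSym_form_n (h : W.IsNormalized U η e a) (hx : x ∈ U) {cov : Cov n M}
    {X Y : VField n M} (hX : MDiffFieldAt X x) (hY : MDiffFieldAt Y x) :
    covSym cov (η (Fin.natAdd n 0)) X Y x =
      - ∑ i, covSym cov (η (Fin.castAdd 2 i)) X Y x := by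
  have h1 : ∀ᶠ y in 𝓝 x, η (Fin.natAdd n 0) y =
      (-(fun y => ∑ i, (1 : ℝ) • η (Fin.castAdd 2 i) y) : OneForm n M) y :=
    Filter.eventually_of_mem (h.mem_nhds hx) fun y hy => by simp [h.form_n hy]
  rw [covSym_congr h1, covSym_neg, covSym_sum_smul (f := fun _ _ => 1)
    (fun _ _ => mdifferentiableAt_const) (fun i _ => h.smooth hx _) hX hY]
  simp [dirDeriv_const]

theorem covSym_form_n_one (h : W.IsNormalized U η e a) (hx : x ∈ U) {cov : Cov n M}
    {X Y : VField n M} (hX : MDiffFieldAt X x) (hY : MDiffFieldAt Y x) :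
    covSym cov (η (Fin.natAdd n 1)) X Y x =
      - ∑ i, (a i x * covSym cov (η (Fin.castAdd 2 i)) X Y x
        + symMul (mvfderiv (𝓡 n) (a i) x) (η (Fin.castAdd 2 i) x) (X x) (Y x)) := by
  have h1 : ∀ᶠ y in 𝓝 x, η (Fin.natAdd n 1) y =
      (-(fun y => ∑ i, a i y • η (Fin.castAdd 2 i) y) : OneForm n M) y :=
    Filter.eventually_of_mem (h.mem_nhds hx) fun y hy => by simp [h.form_n_one hy]
  rw [covSym_congr h1, covSym_neg, covSym_sum_smul
    (fun i _ => (h.smooth_a hx i).mdifferentiableAt (by simp)) (fun i _ => h.smooth hx _) hX hY]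
  rfl

theorem symForm_form_n (h : W.IsNormalized U η e a) (hx : x ∈ U) {cov : Cov n M}
    (hc : IsTorsionFreeAt cov x) (u v : TangentSpace (𝓡 n) x) :
    symForm hc (h.smooth hx (Fin.natAdd n 0)) u v =
      - ∑ i, symForm hc (h.smooth hx (Fin.castAdd 2 i)) u v :=
  h.covSym_form_n hx (smoothFieldAt_extend u).mdiff (smoothFieldAt_extend v).mdiff

theorem symForm_form_n_one (h : W.IsNormalized U η e a) (hx : x ∈ U) {cov : Cov n M}
    (hc : IsTorsionFreeAt cov x) (u v : TangentSpace (𝓡 n) x) :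
    symForm hc (h.smooth hx (Fin.natAdd n 1)) u v =
      - ∑ i, (a i x * symForm hc (h.smooth hx (Fin.castAdd 2 i)) u v
        + symMul (mvfderiv (𝓡 n) (a i) x) (η (Fin.castAdd 2 i) x) u v) := by
  have := h.covSym_form_n_one hx (cov := cov) (smoothFieldAt_extend u).mdiff
    (smoothFieldAt_extend v).mdiff
  simp only [FiberBundle.extend_apply_self] at this
  exact this

/-- If the symmetric covariant differentials of the forms `η_i`, `i ≤ n`, at `x` are `θ_i · η_i`
with `θ_i = θ + ∑ j, s_ij η_j`, then all leaves through `x` are totally geodesic at `x`. -/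
theorem geodesicAt_of_symForm (h : W.IsNormalized U η e a) (hx : x ∈ U) {cov : Cov n M}
    (hc : IsTorsionFreeAt cov x) (θ : TangentSpace (𝓡 n) x →L[ℝ] ℝ)
    (hθ : ∀ i u v, symForm hc (h.smooth hx (Fin.castAdd 2 i)) u v =
      symMul (θ + ∑ j, sCoeff e a i j x • η (Fin.castAdd 2 j) x) (η (Fin.castAdd 2 i) x) u v)
    (k : Fin (n + 2)) : W.GeodesicAt cov x k := by
  rw [h.isGivenBy.geodesicAt_iff h.isOpen hx hc]
  intro u v hu hv
  simp only [h.sCoeff_eq hx] at hθ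
  induction k using Fin.addCases with
  | left i => simp [hθ, symMul, hu, hv]
  | right j =>
    fin_cases j
    · simp only [Fin.zero_eta] at hu hv ⊢
      rw [h.symForm_form_n hx]
      simp only [hθ]
      rw [sum_symMul_eq]
      simp only [h.form_n hx, neg_apply, neg_eq_zero] at hu hv
      simp [symMul, hu, hv]
    · simp only [Fin.mk_one] at hu hv ⊢
      rw [h.symForm_form_n_one hx]
      simp only [hθ]
      simp only [h.form_n_one hx, neg_apply, neg_eq_zero, sum_apply, smul_apply,
        smul_eq_mul] at hu hv
      rw [sum_symMul_vanish (h.eq_sum hx) (h.a_ne_zero hx) (h.a_ne hx) θ hu hv, neg_zero]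

/-- The function `η_i (e i)` is constant, so its derivative does not contribute. -/
theorem symForm_e_e (h : W.IsNormalized U η e a) (hx : x ∈ U) {cov : Cov n M}
    (hc : IsTorsionFreeAt cov x) (i : Fin n) :
    symForm hc (h.smooth hx (Fin.castAdd 2 i)) (e i x) (e i x) =
      - η (Fin.castAdd 2 i) x (cov (e i) x (e i x)) := by
  have h1 : (fun y => η (Fin.castAdd 2 i) y (e i y)) =ᶠ[𝓝 x] fun _ => 1 :=
    Filter.eventually_of_mem (h.mem_nhds hx) fun y hy => by simp [h.dual y hy]
  rw [symForm_apply hc _ (h.smooth_e hx i).mdiff (h.smooth_e hx i).mdiff, covSym,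
    dirDeriv_congr h1, dirDeriv_const]
  ring

/-- The converse of `geodesicAt_of_symForm`. -/
theorem symForm_of_geodesicAt (h : W.IsNormalized U η e a) (hx : x ∈ U) {cov : Cov n M}
    (hc : IsTorsionFreeAt cov x) (hg : ∀ k, W.GeodesicAt cov x k) (i : Fin n)
    (u v : TangentSpace (𝓡 n) x) : symForm hc (h.smooth hx (Fin.castAdd 2 i)) u v =
      symMul (thetaForm cov η e x + ∑ j, sCoeff e a i j x • η (Fin.castAdd 2 j) x)
        (η (Fin.castAdd 2 i) x) u v := by
  have hker (k) := (h.isGivenBy.geodesicAt_iff h.isOpen hx hc k).1 (hg k)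
  simp only [h.sCoeff_eq hx, thetaForm, ← h.symForm_e_e hx hc]
  refine eq_symMul_of_vanish (h.dual x hx) (h.eq_sum hx) (h.a_ne_zero hx) (h.a_ne hx)
    (fun i => symForm_comm hc _) (fun i => hker _) (fun u hu => ?_) (fun u hu => ?_) i u v
  · have hu' : η (Fin.natAdd n 0) x u = 0 := by simp [h.form_n hx, hu]
    have := hker (Fin.natAdd n 0) u u hu' hu'
    rwa [h.symForm_form_n hx, neg_eq_zero] at this
  · have hu' : η (Fin.natAdd n 1) x u = 0 := by simp [h.form_n_one hx, hu]
    have := hker (Fin.natAdd n 1) u u hu' hu'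
    rw [h.symForm_form_n_one hx, neg_eq_zero] at this
    rw [← this]
    refine Finset.sum_congr rfl fun i _ => ?_
    simp only [symMul]
    ring

end Web.IsNormalized

end NormalForm

/-! ### Existence of normal forms -/

section Normalization

variable {n : ℕ} {M : Type*} [TopologicalSpace M] [ChartedSpace (EuclideanSpace ℝ (Fin n)) M]

theorem exists_dual_of_linearIndependent {x : M} {φ : Fin n → TangentSpace (𝓡 n) x →L[ℝ] ℝ}
    (hφ : LinearIndependent ℝ φ) :
    ∃ e : Fin n → TangentSpace (𝓡 n) x, ∀ i j, φ i (e j) = if i = j then 1 else 0 := by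
  let L : TangentSpace (𝓡 n) x →ₗ[ℝ] (Fin n → ℝ) := LinearMap.pi fun i => (φ i).toLinearMap
  have hinj : Function.Injective L := by
    rw [injective_iff_map_eq_zero]
    exact fun w hw => eq_zero_of_linearIndependent hφ fun k => congrFun hw k
  have hsurj : Function.Surjective L :=
    (LinearMap.injective_iff_surjective_of_finrank_eq_finrank
      (by rw [finrank_tangentSpace, Module.finrank_fin_fun])).1 hinj
  choose e he using fun j : Fin n => hsurj (Pi.single j 1)
  refine ⟨e, fun i j => ?_⟩
  have := congrFun (he j) i
  simpa [L, Pi.single_apply] using this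

theorem covector_eq_sum_of_dual {x : M} {φ : Fin n → TangentSpace (𝓡 n) x →L[ℝ] ℝ}
    {e : Fin n → TangentSpace (𝓡 n) x} (hd : ∀ i j, φ i (e j) = if i = j then 1 else 0)
    (ψ : TangentSpace (𝓡 n) x →L[ℝ] ℝ) : ψ = ∑ i, ψ (e i) • φ i := by
  ext v
  conv_lhs => rw [tangent_eq_sum_of_dual hd v]
  simp [mul_comm]

theorem exists_covector_apply_eq_one {x : M} {u : TangentSpace (𝓡 n) x} (hu : u ≠ 0) :
    ∃ φ : TangentSpace (𝓡 n) x →L[ℝ] ℝ, φ u = 1 :=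
  SeparatingDual.exists_eq_one (R := ℝ) (V := EuclideanSpace ℝ (Fin n)) hu

variable [IsManifold (𝓡 n) ∞ M]

theorem extD_smul {η : OneForm n M} {c : M → ℝ} {X Y : VField n M} {x : M}
    (hη : SmoothFormAt η x) (hc : MDifferentiableAt (𝓡 n) 𝓘(ℝ) c x) (hX : SmoothFieldAt X x)
    (hY : SmoothFieldAt Y x) : extD (fun y => c y • η y) X Y x =
      c x * extD η X Y x + dirDeriv X c x * η x (Y x) - dirDeriv Y c x * η x (X x) := by
  simp only [extD, smul_apply, smul_eq_mul]
  rw [dirDeriv_mul hc (hη.mdiff_apply hY.mdiff), dirDeriv_mul hc (hη.mdiff_apply hX.mdiff)]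
  ring

/-- Multiplying the forms of a web by nonvanishing functions gives a web. -/
theorem IsWebOn.smul {d : ℕ} {U : Set M} {η : Fin d → OneForm n M} (h : IsWebOn U η)
    {c : Fin d → M → ℝ} (hc : ∀ i, ∀ x ∈ U, ContMDiffAt (𝓡 n) 𝓘(ℝ) ∞ (c i) x)
    (hc0 : ∀ i, ∀ x ∈ U, c i x ≠ 0) : IsWebOn U (fun i y => c i y • η i y) where
  smooth i x hx := (h.smooth i x hx).smul (hc i x hx)
  ne_zero i x hx := smul_ne_zero (hc0 i x hx) (h.ne_zero i x hx)
  integrable i x hx X Y Z hX hY hZ := by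
    have hw := h.integrable i x hx X Y Z hX hY hZ
    have hd := (hc i x hx).mdifferentiableAt (by simp)
    have hs := h.smooth i x hx
    simp only [wedgeExtD] at hw ⊢
    rw [extD_smul hs hd hX hY, extD_smul hs hd hY hZ, extD_smul hs hd hZ hX]
    simp only [smul_apply, smul_eq_mul]
    linear_combination (c i x) ^ 2 * hw
  independent x hx σ :=
    (h.independent x hx σ).units_smul fun k => Units.mk0 (c (σ k) x) (hc0 (σ k) x hx)

/-- Near every point a web is given by normalized forms. -/
theorem Web.exists_isNormalized (W : Web n M (n + 2)) (x : M) :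
    ∃ U η e a, x ∈ U ∧ W.IsNormalized U η e a := by
  classical
  obtain ⟨U, hU, hxU, η, hη, hker⟩ := W.locally_given x
  have hdual : ∀ y : M, ∃ e : Fin n → TangentSpace (𝓡 n) y, y ∈ U →
      ∀ i j, η (Fin.castAdd 2 i) y (e j) = if i = j then 1 else 0 := by
    intro y
    by_cases hy : y ∈ U
    · obtain ⟨e, he⟩ := exists_dual_of_linearIndependent
        (hη.independent y hy (Fin.castAddEmb 2))
      exact ⟨e, fun _ => he⟩
    · exact ⟨0, fun h => absurd h hy⟩
  choose f hf using hdual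
  have hfs (j : Fin n) (y : M) (hy : y ∈ U) : SmoothFieldAt (fun z => f z j) y :=
    smoothFieldAt_of_dual (e := fun j z => f z j) (fun i => hη.smooth _ y hy)
      (Filter.eventually_of_mem (hU.mem_nhds hy) fun z hz => hf z hz) j
  -- `η_i` is to be multiplied by its coefficient in `-η_{n+1}`
  let b (i : Fin n) (y : M) : ℝ := - η (Fin.natAdd n 0) y (f y i)
  have hb0 (i : Fin n) (y : M) (hy : y ∈ U) : b i y ≠ 0 :=
    neg_ne_zero.2 (hη.apply_ne_zero hy (hf y hy) 0 i)
  have hbs (i : Fin n) (y : M) (hy : y ∈ U) : ContMDiffAt (𝓡 n) 𝓘(ℝ) ∞ (b i) y :=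
    ((hη.smooth _ y hy).apply (hfs i y hy)).neg
  let c : Fin (n + 2) → M → ℝ := Fin.addCases b (fun _ _ => 1)
  have hc0 (k : Fin (n + 2)) (y : M) (hy : y ∈ U) : c k y ≠ 0 := by
    induction k using Fin.addCases with
    | left i => simpa [c] using hb0 i y hy
    | right j => simp [c]
  have hcs (k : Fin (n + 2)) (y : M) (hy : y ∈ U) : ContMDiffAt (𝓡 n) 𝓘(ℝ) ∞ (c k) y := by
    induction k using Fin.addCases with
    | left i => simpa [c] using hbs i y hy
    | right j => simpa [c] using contMDiffAt_const
  have hd (y : M) (hy : y ∈ U) (i j : Fin n) : (c (Fin.castAdd 2 i) y • η (Fin.castAdd 2 i) y)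
      ((b j y)⁻¹ • f y j) = if i = j then 1 else 0 := by
    by_cases hij : i = j
    · subst hij
      simp [c, hf y hy, hb0 i y hy]
    · simp [hf y hy, hij]
  refine ⟨U, fun k y => c k y • η k y, fun j y => (b j y)⁻¹ • f y j,
    fun i y => - η (Fin.natAdd n 1) y ((b i y)⁻¹ • f y i), hxU, hU,
    ⟨hη.smul hcs hc0, ?_⟩, hd, ?_, ?_⟩
  · intro k y hy
    rw [hker k y hy]
    ext v
    simp [hc0 k y hy]
  · intro y hy
    have h1 := covector_eq_sum_of_dual (hf y hy) (η (Fin.natAdd n 0) y)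
    ext v
    have h2 := congr($h1 v)
    simp only [sum_apply, smul_apply, smul_eq_mul] at h2
    simp [c, b, h2]
  · intro y hy
    have h1 := covector_eq_sum_of_dual (hd y hy) (η (Fin.natAdd n 1) y)
    ext v
    have h2 := congr($h1 v)
    simp only [sum_apply, smul_apply, smul_eq_mul] at h2
    simp only [c, Fin.addCases_right, one_smul, add_apply, sum_apply, smul_apply, smul_eq_mul,
      neg_mul, Finset.sum_neg_distrib, zero_apply]
    rw [h2]
    exact neg_add_cancel _

end Normalization

/-! ### Geodesic connections are projectively equivalent -/

section Uniqueness

variable {n : ℕ} {M : Type*} [TopologicalSpace M] [ChartedSpace (EuclideanSpace ℝ (Fin n)) M]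
  [IsManifold (𝓡 n) ∞ M]

/-- The covariant differential of a vector field that is smooth on an open set is smooth there.
(In the definition of a smooth connection the fields are required to be smooth everywhere.) -/
theorem TorsionFreeConnection.smooth_cov [T2Space M] (D : TorsionFreeConnection n M) {U : Set M}
    (hU : IsOpen U) {Y : VField n M} (hY : ∀ y ∈ U, SmoothFieldAt Y y) {x : M} (hx : x ∈ U) :
    ContMDiffAt (𝓡 n) ((𝓡 n).prod 𝓘(ℝ, EuclideanSpace ℝ (Fin n) →L[ℝ] EuclideanSpace ℝ (Fin n))) ∞
      (fun y => TotalSpace.mk' (EuclideanSpace ℝ (Fin n) →L[ℝ] EuclideanSpace ℝ (Fin n))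
        (E := fun y : M => TangentSpace (𝓡 n) y →L[ℝ] TangentSpace (𝓡 n) y) y (D.cov Y y)) x := by
  obtain ⟨f, -, hf⟩ := (SmoothBumpFunction.nhds_basis_tsupport (I := 𝓡 n) x).mem_iff.1
    (hU.mem_nhds hx)
  have hfY : ∀ y, SmoothFieldAt (fun z => f z • Y z) y := by
    have : ContMDiffOn (𝓡 n) ((𝓡 n).prod 𝓘(ℝ, EuclideanSpace ℝ (Fin n))) ∞
      (fun y : M => TotalSpace.mk' (EuclideanSpace ℝ (Fin n))
        (E := (TangentSpace (𝓡 n) : M → Type _)) y (Y y)) U :=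
      fun y hy => (hY y hy).contMDiffWithinAt
    exact ContMDiffOn.smul_section_of_tsupport f.contMDiff.contMDiffOn hU hf this
  have h1 := D.smooth.contMDiff.contMDiff (σ := fun z => f z • Y z)
    (contMDiffOn_univ.2 fun y => by simpa using! hfY y)
  refine ((contMDiffOn_univ.1 h1) x).congr_of_eventuallyEq ?_
  filter_upwards [f.eventuallyEq_one.eventually_nhds, hU.mem_nhds hx] with y hy hyU
  have : D.cov Y y = D.cov (fun z => f z • Y z) y :=
    D.cov.isCovariantDerivativeOnUniv.congr_of_eventuallyEq (hY y hyU).mdiff (hfY y).mdiff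
      Filter.univ_mem (hy.mono fun z hz => by simp [hz])
  rw [this]

theorem Web.IsNormalized.smooth_thetaForm [T2Space M] {W : Web n M (n + 2)} {U : Set M}
    {η : Fin (n + 2) → OneForm n M} {e : Fin n → VField n M} {a : Fin n → M → ℝ}
    (h : W.IsNormalized U η e a) (D : TorsionFreeConnection n M) {x : M} (hx : x ∈ U) :
    SmoothFormAt (thetaForm D.cov η e) x :=
  .finsetSum fun i _ => (h.smooth hx _).smul <| ContMDiffAt.neg <| (h.smooth hx _).apply <|
    ContMDiffAt.clm_bundle_apply (D.smooth_cov h.isOpen (fun _ hy => h.smooth_e hy i) hx)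
      (h.smooth_e hx i)

/-- The derivatives of `η (X)` and `η (Y)` cancel, and the difference of two torsion-free
connections is a symmetric tensor. -/
theorem covSym_sub_covSym (D D' : TorsionFreeConnection n M) {x : M} {η : OneForm n M}
    {X Y : VField n M} (hX : MDiffFieldAt X x) (hY : MDiffFieldAt Y x) :
    covSym D.cov η X Y x - covSym D'.cov η X Y x =
      - η x (D.cov.difference D'.cov x (Y x) (X x)) := by
  have h1 : D.cov.difference D'.cov x (Y x) = D.cov Y x - D'.cov Y x :=
    IsCovariantDerivativeOn.difference_apply _ _ (hx := Set.mem_univ x) hY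
  have h2 := (D.isTorsionFreeAt x).torsion X Y hX hY
  have h3 := (D'.isTorsionFreeAt x).torsion X Y hX hY
  have h4 : D.cov Y x (X x) - D'.cov Y x (X x) = D.cov X x (Y x) - D'.cov X x (Y x) := by
    rw [sub_eq_sub_iff_sub_eq_sub, h2, h3]
  have h5 := congrArg (η x) h4
  simp only [map_sub] at h5
  rw [h1]
  simp only [covSym, sub_apply, map_sub]
  linarith

theorem symForm_sub_symForm (D D' : TorsionFreeConnection n M) {x : M} {η : OneForm n M}
    (hη : SmoothFormAt η x) (u v : TangentSpace (𝓡 n) x) :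
    symForm (D.isTorsionFreeAt x) hη u v - symForm (D'.isTorsionFreeAt x) hη u v =
      - η x (D.cov.difference D'.cov x v u) := by
  have := covSym_sub_covSym D D' (η := η) (smoothFieldAt_extend u).mdiff
    (smoothFieldAt_extend v).mdiff
  simp only [FiberBundle.extend_apply_self] at this
  exact this

/-- The difference of two connections for which the web is geodesic is `θ' - θ`, symmetrized with
the identity: the coefficients `s_ij` are the same for both. -/
theorem Web.IsNormalized.difference_eq {W : Web n M (n + 2)} {U : Set M}
    {η : Fin (n + 2) → OneForm n M} {e : Fin n → VField n M} {a : Fin n → M → ℝ}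
    (h : W.IsNormalized U η e a) {D D' : TorsionFreeConnection n M} {x : M} (hx : x ∈ U)
    (hD : W.IsGeodesic D) (hD' : W.IsGeodesic D') (φ : TangentSpace (𝓡 n) x →L[ℝ] ℝ)
    (u v : TangentSpace (𝓡 n) x) :
    - φ (D.cov.difference D'.cov x v u) =
      symMul (thetaForm D.cov η e x - thetaForm D'.cov η e x) φ u v := by
  have hi (i : Fin n) : - η (Fin.castAdd 2 i) x (D.cov.difference D'.cov x v u) =
      symMul (thetaForm D.cov η e x - thetaForm D'.cov η e x) (η (Fin.castAdd 2 i) x) u v := by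
    rw [← symForm_sub_symForm D D' (h.smooth hx _), h.symForm_of_geodesicAt hx
      (D.isTorsionFreeAt x) (Web.isGeodesic_iff.1 hD x), h.symForm_of_geodesicAt hx
      (D'.isTorsionFreeAt x) (Web.isGeodesic_iff.1 hD' x)]
    simp only [symMul, add_apply, sub_apply]
    ring
  have hφ := covector_eq_sum_of_dual (h.dual x hx) φ
  generalize D.cov.difference D'.cov x v u = w at hi ⊢
  have hφ' (w : TangentSpace (𝓡 n) x) : φ w = ∑ i, φ (e i x) * η (Fin.castAdd 2 i) x w := by
    conv_lhs => rw [hφ]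
    simp
  simp only [symMul] at hi ⊢
  rw [hφ' w, hφ' u, hφ' v, Finset.mul_sum, Finset.mul_sum, ← Finset.sum_add_distrib,
    Finset.sum_div, ← Finset.sum_neg_distrib]
  refine Finset.sum_congr rfl fun i _ => ?_
  linear_combination φ (e i x) * hi i

/-- Two connections for which a web is geodesic are projectively equivalent. -/
theorem Web.IsGeodesic.projEquiv [T2Space M] {W : Web n M (n + 2)}
    {D D' : TorsionFreeConnection n M}
    (hD : W.IsGeodesic D) (hD' : W.IsGeodesic D') : ProjEquiv D D' := by
  have hex (x : M) : ∃ ρ : TangentSpace (𝓡 n) x →L[ℝ] ℝ,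
      ∀ φ u v, - φ (D.cov.difference D'.cov x v u) = symMul ρ φ u v := by
    obtain ⟨U, η, e, a, hx, h⟩ := W.exists_isNormalized x
    exact ⟨_, h.difference_eq hx hD hD'⟩
  choose ρ hρ using hex
  refine ⟨ρ, fun x => ?_, fun x η X Y hη hX hY => ?_⟩
  · obtain ⟨U, η, e, a, hx, h⟩ := W.exists_isNormalized x
    have h1 : SmoothFormAt (thetaForm D.cov η e - thetaForm D'.cov η e) x :=
      ContMDiffAt.sub_section (h.smooth_thetaForm D hx) (h.smooth_thetaForm D' hx)
    refine h1.congr (Filter.eventually_of_mem (h.mem_nhds hx) fun y hy => ?_)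
    refine eq_of_symMul_eq (fun u hu => exists_covector_apply_eq_one hu) fun φ u v => ?_
    rw [← hρ, h.difference_eq hy hD hD']
    rfl
  · rw [symCovDiff_eq, symCovDiff_eq, covSym_sub_covSym D D' hX.mdiff hY.mdiff, hρ]
    rfl

/-- A web that is geodesic for a connection is geodesic for all projectively equivalent ones. -/
theorem Web.IsGeodesic.of_projEquiv {d : ℕ} {W : Web n M d} {D D' : TorsionFreeConnection n M}
    (hD : W.IsGeodesic D) (h : ProjEquiv D D') : W.IsGeodesic D' := by
  obtain ⟨ρ, -, hρ⟩ := h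
  rw [Web.isGeodesic_iff] at hD ⊢
  intro x i
  obtain ⟨U, hU, hx, η, hη⟩ := W.locally_given x
  have hη' : W.IsGivenBy U η := hη
  have h1 := (hη'.geodesicAt_iff hU hx (D.isTorsionFreeAt x) i).1 (hD x i)
  refine (hη'.geodesicAt_iff hU hx (D'.isTorsionFreeAt x) i).2 fun u v hu hv => ?_
  have h2 := hρ x (η i) _ _ (hη'.1.smooth i x hx) (smoothFieldAt_extend u) (smoothFieldAt_extend v)
  rw [symCovDiff_eq, symCovDiff_eq, covSym_sub_covSym D D' (smoothFieldAt_extend u).mdiff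
    (smoothFieldAt_extend v).mdiff] at h2
  simp only [symProd, FiberBundle.extend_apply_self, hu, hv, mul_zero, add_zero, zero_div] at h2
  rw [← symForm_sub_symForm D D' (hη'.1.smooth i x hx), h1 u v hu hv] at h2
  linarith

theorem projClass_eq_iff {D D' : TorsionFreeConnection n M} :
    D.projClass = D'.projClass ↔ ProjEquiv D D' :=
  Quotient.eq

theorem Web.isGeodesicIn_projClass {d : ℕ} {W : Web n M d} {D : TorsionFreeConnection n M}
    (hD : W.IsGeodesic D) : W.IsGeodesicIn D.projClass := fun _ h =>
  hD.of_projEquiv (projClass_eq_iff.1 h.symm)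

/-- The connections for which an `(n+2)`-web is geodesic form one projective class. -/
theorem Web.IsGeodesicIn.projClass_eq_iff [T2Space M] {W : Web n M (n + 2)}
    {P : ProjectiveStructure n M} (hP : W.IsGeodesicIn P) {D : TorsionFreeConnection n M} :
    D.projClass = P ↔ W.IsGeodesic D := by
  refine ⟨hP D, fun hD => ?_⟩
  obtain ⟨D', rfl⟩ : ∃ D' : TorsionFreeConnection n M, D'.projClass = P := Quotient.exists_rep P
  exact HypersurfaceWeb.projClass_eq_iff.2 (hD.projEquiv (hP D' rfl))

/-- A torsion-free connection is determined at a point by the symmetric covariant differentials of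
the forms of a coframe. -/
theorem Web.IsNormalized.cov_eq_of_symForm_eq {W : Web n M (n + 2)} {U : Set M}
    {η : Fin (n + 2) → OneForm n M} {e : Fin n → VField n M} {a : Fin n → M → ℝ}
    (h : W.IsNormalized U η e a) {D D' : TorsionFreeConnection n M} {x : M} (hx : x ∈ U)
    (hDD' : ∀ (i : Fin n) u v, symForm (D.isTorsionFreeAt x) (h.smooth hx (Fin.castAdd 2 i)) u v =
      symForm (D'.isTorsionFreeAt x) (h.smooth hx (Fin.castAdd 2 i)) u v)
    {Y : VField n M} (hY : SmoothFieldAt Y x) : D.cov Y x = D'.cov Y x := by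
  have h1 : D.cov.difference D'.cov x (Y x) = D.cov Y x - D'.cov Y x :=
    IsCovariantDerivativeOn.difference_apply _ _ (hx := Set.mem_univ x) hY.mdiff
  rw [← sub_eq_zero, ← h1]
  ext1 u
  have h2 (i : Fin n) : η (Fin.castAdd 2 i) x (D.cov.difference D'.cov x (Y x) u) = 0 := by
    rw [← neg_eq_zero, ← symForm_sub_symForm D D' (h.smooth hx _), hDD', sub_self]
  rw [h.eq_sum hx (D.cov.difference D'.cov x (Y x) u)]
  simp [h2]

end Uniqueness

/-! ### Connections with prescribed symmetric covariant differentials -/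

section LocalConnection

variable {n : ℕ} {M : Type*} [TopologicalSpace M] [ChartedSpace (EuclideanSpace ℝ (Fin n)) M]

theorem extD_antisymm (η : OneForm n M) (X Y : VField n M) (x : M) :
    extD η X Y x = - extD η Y X x := by
  simp only [extD]
  rw [VectorField.mlieBracket_swap_apply, map_neg]
  ring

/-- For a coframe `η` with dual frame `e` and one-forms `φ`, the torsion-free connection for which
the symmetric covariant differential of `η i` is `φ i · η i`. It is given by
`η i (∇_X Y) = X (η i Y) - (φ i · η i) (X, Y) - dη i (X, Y) / 2`, where `dη i` is expanded in the
coframe. -/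
def coframeCov (η φ : Fin n → OneForm n M) (e : Fin n → VField n M) : Cov n M := fun Y x =>
  ∑ i, (mvfderiv (𝓡 n) (fun y => η i y (Y y)) x
    - (1 / 2 : ℝ) • (φ i x (Y x) • η i x + η i x (Y x) • φ i x)
    - (1 / 2 : ℝ) • ∑ j, ∑ k, (extD (η i) (e j) (e k) x * η k x (Y x)) • η j x).smulRight (e i x)

variable {η φ : Fin n → OneForm n M} {e : Fin n → VField n M} {x : M}

theorem apply_coframeCov (hd : ∀ i j, η i x (e j x) = if i = j then 1 else 0) (i : Fin n)
    (X Y : VField n M) : η i x (coframeCov η φ e Y x (X x)) =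
      dirDeriv X (fun y => η i y (Y y)) x - symMul (φ i x) (η i x) (X x) (Y x)
        - (∑ j, ∑ k, η j x (X x) * extD (η i) (e j) (e k) x * η k x (Y x)) / 2 := by
  have h1 (c : Fin n → ℝ) : η i x (∑ l, c l • e l x) = c i := by
    simp [hd]
  simp only [coframeCov, sum_apply, ContinuousLinearMap.smulRight_apply, h1, sub_apply, add_apply,
    smul_apply, smul_eq_mul, symMul, dirDeriv]
  have h2 : ∑ j, ∑ k, extD (η i) (e j) (e k) x * η k x (Y x) * η j x (X x) =
      ∑ j, ∑ k, η j x (X x) * extD (η i) (e j) (e k) x * η k x (Y x) :=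
    Finset.sum_congr rfl fun j _ => Finset.sum_congr rfl fun k _ => by ring
  rw [h2]
  ring

theorem eq_of_coframe_eq (hd : ∀ i j, η i x (e j x) = if i = j then 1 else 0)
    {u v : TangentSpace (𝓡 n) x} (h : ∀ i, η i x u = η i x v) : u = v := by
  rw [tangent_eq_sum_of_dual hd u, tangent_eq_sum_of_dual hd v]
  simp only [h]

variable [IsManifold (𝓡 n) ∞ M]

/-- The exterior derivative is tensorial, the derivatives of the factor in the Leibniz rules for
functions and for the Lie bracket cancelling. -/
theorem extD_tensorial {x : M} {η : OneForm n M} (hη : SmoothFormAt η x) (Y : VField n M) :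
    TensorialAt (𝓡 n) (EuclideanSpace ℝ (Fin n)) (fun X => extD η X Y x) x where
  smul {f X} hf hX := by
    have h2 : dirDeriv Y (fun y => η y ((f • X) y)) x = f x * dirDeriv Y (fun y => η y (X y)) x
        + dirDeriv Y f x * η x (X x) := by
      rw [← dirDeriv_mul hf (hη.mdiff_apply hX)]
      simp
    have h3 : dirDeriv (f • X) (fun y => η y (Y y)) x =
        f x * dirDeriv X (fun y => η y (Y y)) x := by
      simp [dirDeriv]
    unfold extD
    rw [h2, h3, VectorField.mlieBracket_smul_left hf hX]
    simp only [map_add, map_smul, smul_eq_mul, dirDeriv]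
    ring
  add {X X'} hX hX' := by
    have h2 : dirDeriv Y (fun y => η y ((X + X') y)) x = dirDeriv Y (fun y => η y (X y)) x
        + dirDeriv Y (fun y => η y (X' y)) x := by
      rw [← dirDeriv_add (hη.mdiff_apply hX) (hη.mdiff_apply hX')]
      simp
    have h3 : dirDeriv (X + X') (fun y => η y (Y y)) x = dirDeriv X (fun y => η y (Y y)) x
        + dirDeriv X' (fun y => η y (Y y)) x := by
      simp [dirDeriv]
    unfold extD
    rw [h2, h3, VectorField.mlieBracket_add_left hX hX', map_add]
    ring

theorem SmoothFormAt.extD {η : OneForm n M} {X Y : VField n M} {x : M} (hη : SmoothFormAt η x)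
    (hX : SmoothFieldAt X x) (hY : SmoothFieldAt Y x) :
    ContMDiffAt (𝓡 n) 𝓘(ℝ) ∞ (extD η X Y) x := by
  have : IsManifold (𝓡 n) (((⊤ : ℕ∞) : WithTop ℕ∞) + 1) M := by simpa
  have : IsManifold (𝓡 n) (minSmoothness ℝ 2) M := by
    rw [minSmoothness_of_isRCLikeNormedField]
    infer_instance
  have hb : SmoothFieldAt (VectorField.mlieBracket (𝓡 n) X Y) x :=
    ContMDiffAt.mlieBracket_vectorField (m := ⊤) (n := ⊤) hX hY (by simp)
  exact ((hX.dirDeriv (hη.apply hY)).sub (hY.dirDeriv (hη.apply hX))).sub (hη.apply hb)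

/-- The exterior derivative is determined by its values on a frame. -/
theorem extD_eq_sum {ψ : OneForm n M} {η : Fin n → OneForm n M} {e : Fin n → VField n M} {x : M}
    (hψ : SmoothFormAt ψ x) (he : ∀ j, SmoothFieldAt (e j) x)
    (hd : ∀ i j, η i x (e j x) = if i = j then 1 else 0) {X Y : VField n M}
    (hX : MDiffFieldAt X x) (hY : MDiffFieldAt Y x) :
    extD ψ X Y x = ∑ j, ∑ k, η j x (X x) * extD ψ (e j) (e k) x * η k x (Y x) := by
  let B := TensorialAt.mkHom₂ (I := 𝓡 n) (F := EuclideanSpace ℝ (Fin n))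
    (F' := EuclideanSpace ℝ (Fin n)) (fun X Y => extD ψ X Y x) x (fun Y _ => extD_tensorial hψ Y)
    (fun X _ => by
      have := (extD_tensorial hψ X)
      refine ⟨fun hf hZ => ?_, fun hZ hZ' => ?_⟩
      · rw [extD_antisymm, this.smul hf hZ, extD_antisymm ψ X, smul_neg]
      · rw [extD_antisymm, this.add hZ hZ', extD_antisymm ψ X, extD_antisymm ψ X, neg_add])
  have hB {Z W : VField n M} (hZ : MDiffFieldAt Z x) (hW : MDiffFieldAt W x) :
      B (Z x) (W x) = extD ψ Z W x := TensorialAt.mkHom₂_apply _ _ hZ hW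
  rw [← hB hX hY]
  conv_lhs => rw [tangent_eq_sum_of_dual hd (X x), tangent_eq_sum_of_dual hd (Y x)]
  simp only [map_sum, map_smul, sum_apply, smul_apply, smul_eq_mul, Finset.mul_sum,
    hB (he _).mdiff (he _).mdiff]
  rw [Finset.sum_comm]
  exact Finset.sum_congr rfl fun j _ => Finset.sum_congr rfl fun k _ => by ring

theorem isTorsionFreeAt_coframeCov (hη : ∀ i, SmoothFormAt (η i) x)
    (he : ∀ j, SmoothFieldAt (e j) x) (hd : ∀ i j, η i x (e j x) = if i = j then 1 else 0) :
    IsTorsionFreeAt (coframeCov η φ e) x where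
  isCov :=
    { add := by
        intro Y Y' y hY hY' hy
        obtain rfl : y = x := hy
        ext1 v
        refine eq_of_coframe_eq hd fun i => ?_
        let X : VField n M := FiberBundle.extend (EuclideanSpace ℝ (Fin n)) v
        have hX : X y = v := FiberBundle.extend_apply_self _ v
        rw [← hX, add_apply, map_add, apply_coframeCov hd, apply_coframeCov hd, apply_coframeCov hd]
        have h2 : dirDeriv X (fun z => η i z ((Y + Y') z)) y = dirDeriv X (fun z => η i z (Y z)) y
            + dirDeriv X (fun z => η i z (Y' z)) y := by
          rw [← dirDeriv_add ((hη i).mdiff_apply hY) ((hη i).mdiff_apply hY')]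
          simp
        rw [h2]
        simp only [Pi.add_apply, map_add, mul_add, Finset.sum_add_distrib, symMul]
        ring
      leibniz := by
        intro Y f y hY hf hy
        obtain rfl : y = x := hy
        ext1 v
        refine eq_of_coframe_eq hd fun i => ?_
        let X : VField n M := FiberBundle.extend (EuclideanSpace ℝ (Fin n)) v
        have hX : X y = v := FiberBundle.extend_apply_self _ v
        rw [← hX, add_apply, map_add, smul_apply, map_smul, apply_coframeCov hd,
          apply_coframeCov hd]
        have h2 : dirDeriv X (fun z => η i z ((f • Y) z)) y =
            f y * dirDeriv X (fun z => η i z (Y z)) y + dirDeriv X f y * η i y (Y y) := by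
          rw [← dirDeriv_mul hf ((hη i).mdiff_apply hY)]
          simp
        have h3 : ∑ j, ∑ k, η j y (X y) * extD (η i) (e j) (e k) y * η k y ((f • Y) y) =
            f y * ∑ j, ∑ k, η j y (X y) * extD (η i) (e j) (e k) y * η k y (Y y) := by
          simp only [Finset.mul_sum, Pi.smul_apply', map_smul, smul_eq_mul]
          exact Finset.sum_congr rfl fun j _ => Finset.sum_congr rfl fun k _ => by ring
        rw [h2, h3]
        simp only [Pi.smul_apply', map_smul, smul_eq_mul, symMul,
          ContinuousLinearMap.smulRight_apply, dirDeriv]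
        ring }
  torsion X Y hX hY := by
    refine eq_of_coframe_eq hd fun i => ?_
    rw [map_sub, apply_coframeCov hd, apply_coframeCov hd, ← extD_eq_sum (hη i) he hd hX hY,
      ← extD_eq_sum (hη i) he hd hY hX, extD_antisymm _ Y X]
    simp only [extD, symMul]
    ring

theorem symForm_coframeCov (hη : ∀ i, SmoothFormAt (η i) x) (he : ∀ j, SmoothFieldAt (e j) x)
    (hd : ∀ i j, η i x (e j x) = if i = j then 1 else 0) (i : Fin n)
    (u v : TangentSpace (𝓡 n) x) :
    symForm (isTorsionFreeAt_coframeCov (φ := φ) hη he hd) (hη i) u v =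
      symMul (φ i x) (η i x) u v := by
  revert u v
  refine (symForm_eq_iff _ _ _).2 fun X Y hX hY => ?_
  rw [covSym, apply_coframeCov hd, apply_coframeCov hd,
    ← extD_eq_sum (hη i) he hd hX.mdiff hY.mdiff,
    ← extD_eq_sum (hη i) he hd hY.mdiff hX.mdiff, extD_antisymm _ Y X]
  simp only [symMul]
  ring

theorem contMDiffAt_coframeCov (hη : ∀ i, SmoothFormAt (η i) x) (hφ : ∀ i, SmoothFormAt (φ i) x)
    (he : ∀ j, SmoothFieldAt (e j) x) {Y : VField n M} (hY : SmoothFieldAt Y x) :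
    ContMDiffAt (𝓡 n) ((𝓡 n).prod 𝓘(ℝ, EuclideanSpace ℝ (Fin n) →L[ℝ] EuclideanSpace ℝ (Fin n))) ∞
      (fun y => TotalSpace.mk' (EuclideanSpace ℝ (Fin n) →L[ℝ] EuclideanSpace ℝ (Fin n))
        (E := fun y : M => TangentSpace (𝓡 n) y →L[ℝ] TangentSpace (𝓡 n) y) y
        (coframeCov η φ e Y y)) x := by
  refine contMDiffAt_hom_of_apply fun X hX => ?_
  simp only [coframeCov, sum_apply, ContinuousLinearMap.smulRight_apply, sub_apply, add_apply,
    smul_apply, smul_eq_mul]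
  refine SmoothFieldAt.sum fun i _ => (he i).smul ?_
  refine ((hX.dirDeriv ((hη i).apply hY)).sub (contMDiffAt_const.mul ?_)).sub
    (contMDiffAt_const.mul ?_)
  · exact (((hφ i).apply hY).mul ((hη i).apply hX)).add (((hη i).apply hY).mul ((hφ i).apply hX))
  · exact contMDiffAt_finsetSum fun j _ => contMDiffAt_finsetSum fun k _ =>
      (((hη i).extD (he j) (he k)).mul ((hη k).apply hY)).mul ((hη j).apply hX)

end LocalConnection

/-! ### Existence of geodesic connections -/

section Global

variable {n : ℕ} {M : Type*} [TopologicalSpace M] [ChartedSpace (EuclideanSpace ℝ (Fin n)) M]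
  [IsManifold (𝓡 n) ∞ M]

/-- The covariant differentials `cov Y` of smooth vector fields `Y` are smooth near `x`, as sections
of the bundle of endomorphisms of the tangent spaces. -/
def SmoothCovAt (cov : Cov n M) (x : M) : Prop :=
  ∀ Y : VField n M, (∀ y, SmoothFieldAt Y y) →
    ContMDiffAt (𝓡 n) ((𝓡 n).prod 𝓘(ℝ, EuclideanSpace ℝ (Fin n) →L[ℝ] EuclideanSpace ℝ (Fin n))) ∞
      (fun y => TotalSpace.mk' (EuclideanSpace ℝ (Fin n) →L[ℝ] EuclideanSpace ℝ (Fin n))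
        (E := fun y : M => TangentSpace (𝓡 n) y →L[ℝ] TangentSpace (𝓡 n) y) y (cov Y y)) x

/-- The smooth torsion-free connection with the covariant derivative `cov`. -/
def TorsionFreeConnection.ofCov (cov : Cov n M) (h : ∀ x, IsTorsionFreeAt cov x)
    (hs : ∀ x, SmoothCovAt cov x) : TorsionFreeConnection n M where
  cov := ⟨cov, ⟨fun {_ _ x} hY hY' _ => (h x).isCov.add hY hY' rfl,
    fun {_ _ x} hY hf _ => (h x).isCov.leibniz hY hf rfl⟩⟩
  smooth := ⟨⟨fun {Y} hY => contMDiffOn_univ.2 fun x => hs x Y fun y => by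
    simpa using! contMDiffOn_univ.1 hY y⟩⟩
  torsion_eq_zero := by
    rw [CovariantDerivative.torsion_eq_zero_iff]
    exact fun {X Y x} hX hY => (h x).torsion X Y hX hY

/-- Torsion-free connections on the sets of an open cover are glued by a partition of unity. Linear
conditions on the values are inherited, since the values of the glued connection are linear
combinations of those of the given ones. -/
theorem exists_torsionFreeConnection [T2Space M] [SigmaCompactSpace M] {U : M → Set M}
    (hU : ∀ p, IsOpen (U p)) (hmem : ∀ p, p ∈ U p) {cov : M → Cov n M}
    (hc : ∀ p, ∀ x ∈ U p, IsTorsionFreeAt (cov p) x) (hs : ∀ p, ∀ x ∈ U p, SmoothCovAt (cov p) x) :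
    ∃ D : TorsionFreeConnection n M, ∀ (Y : VField n M) (x : M) (v : TangentSpace (𝓡 n) x)
      (S : Submodule ℝ (TangentSpace (𝓡 n) x)), (∀ p, x ∈ U p → cov p Y x v ∈ S) →
        D.cov Y x v ∈ S := by
  obtain ⟨ρ, hρ⟩ := SmoothPartitionOfUnity.exists_isSubordinate (𝓡 n) isClosed_univ U hU
    fun p _ => Set.mem_iUnion.2 ⟨p, hmem p⟩
  let c : Cov n M := fun Y x => ∑ᶠ p, ρ p x • cov p Y x
  have hcs (Y : VField n M) (x : M) : c Y x = ∑ p ∈ ρ.finsupport x, ρ p x • cov p Y x :=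
    (ρ.sum_finsupport_smul_eq_finsum x fun p _ => cov p Y x).symm
  have hsup {p x : M} (hp : p ∈ ρ.finsupport x) : x ∈ U p :=
    hρ p (subset_tsupport _ ((ρ.mem_finsupport x).1 hp))
  have hone (x : M) : ∑ p ∈ ρ.finsupport x, ρ p x = 1 := ρ.sum_finsupport x (Set.mem_univ x)
  have htf (x : M) : IsTorsionFreeAt c x :=
    { isCov :=
        { add := by
            intro Y Y' y hY hY' hy
            obtain rfl : y = x := hy
            rw [hcs, hcs, hcs, ← Finset.sum_add_distrib]
            refine Finset.sum_congr rfl fun p hp => ?_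
            rw [(hc p y (hsup hp)).isCov.add hY hY' rfl, smul_add]
          leibniz := by
            intro Y f y hY hf hy
            obtain rfl : y = x := hy
            rw [hcs, hcs, Finset.smul_sum]
            conv_rhs => rw [← one_smul ℝ (ContinuousLinearMap.smulRight _ _), ← hone y,
              Finset.sum_smul, ← Finset.sum_add_distrib]
            refine Finset.sum_congr rfl fun p hp => ?_
            rw [(hc p y (hsup hp)).isCov.leibniz hY hf rfl, smul_add, smul_comm] }
      torsion := by
        intro X Y hX hY
        rw [hcs, hcs, sum_apply, sum_apply, ← Finset.sum_sub_distrib,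
          ← one_smul ℝ (VectorField.mlieBracket _ _ _ _), ← hone x, Finset.sum_smul]
        refine Finset.sum_congr rfl fun p hp => ?_
        rw [← (hc p x (hsup hp)).torsion X Y hX hY, smul_apply, smul_apply, smul_sub] }
  refine ⟨.ofCov c htf fun x Y hY => ?_, fun Y x v S hS => ?_⟩
  · refine ContMDiff.finsum_section_of_locallyFinite (t := fun p y => ρ p y • cov p Y y) ?_
      (fun p => ?_) x
    · exact ρ.locallyFinite.subset fun p y hy => left_ne_zero_of_smul hy
    · exact ContMDiffOn.smul_section_of_tsupport (ρ p).contMDiff.contMDiffOn (hU p) (hρ p)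
        fun y hy => (hs p y hy Y hY).contMDiffWithinAt
  · change c Y x v ∈ S
    rw [hcs, sum_apply]
    exact S.sum_mem fun p hp => S.smul_mem _ (hS p (hsup hp))

/-- The form `θ_i = θ + ∑ j, s_ij η_j` of the normalized web, by which `η_i` is to be multiplied to
give its symmetric covariant differential. -/
def formFactor (η : Fin (n + 2) → OneForm n M) (e : Fin n → VField n M) (a : Fin n → M → ℝ)
    (θ : OneForm n M) (i : Fin n) : OneForm n M := fun x =>
  θ x + ∑ j, sCoeff e a i j x • η (Fin.castAdd 2 j) x

/-- For a normalized web on `U`, the torsion-free connection on `U` for which the symmetric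
covariant differentials of the `η_i` are `θ_i · η_i`, `θ_i = θ + ∑ j, s_ij η_j`. -/
def webCov (η : Fin (n + 2) → OneForm n M) (e : Fin n → VField n M)
    (a : Fin n → M → ℝ) (θ : OneForm n M) : Cov n M :=
  coframeCov (fun i => η (Fin.castAdd 2 i)) (formFactor η e a θ) e

namespace Web.IsNormalized

variable {W : Web n M (n + 2)} {U : Set M} {η : Fin (n + 2) → OneForm n M} {e : Fin n → VField n M}
  {a : Fin n → M → ℝ} {θ : OneForm n M} {x : M}

theorem isTorsionFreeAt_webCov (h : W.IsNormalized U η e a) (hx : x ∈ U) :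
    IsTorsionFreeAt (webCov η e a θ) x :=
  isTorsionFreeAt_coframeCov (fun _ => h.smooth hx _) (h.smooth_e hx) (h.dual x hx)

theorem smoothCovAt_webCov (h : W.IsNormalized U η e a) (hx : x ∈ U) (hθ : SmoothFormAt θ x) :
    SmoothCovAt (webCov η e a θ) x := fun _ hY =>
  contMDiffAt_coframeCov (fun _ => h.smooth hx _) (fun i => SmoothFormAt.sum hθ <|
    .finsetSum fun j _ => (h.smooth hx _).smul (h.smooth_sCoeff hx i j)) (h.smooth_e hx) (hY x)

theorem symForm_webCov (h : W.IsNormalized U η e a) (hx : x ∈ U) (i : Fin n)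
    (u v : TangentSpace (𝓡 n) x) :
    symForm (h.isTorsionFreeAt_webCov (θ := θ) hx) (h.smooth hx (Fin.castAdd 2 i)) u v =
      symMul (formFactor η e a θ i x) (η (Fin.castAdd 2 i) x) u v :=
  symForm_coframeCov (fun _ => h.smooth hx _) (h.smooth_e hx) (h.dual x hx) i u v

theorem geodesicAt_webCov (h : W.IsNormalized U η e a) (hx : x ∈ U) (k : Fin (n + 2)) :
    W.GeodesicAt (webCov η e a θ) x k :=
  h.geodesicAt_of_symForm hx (h.isTorsionFreeAt_webCov hx) (θ x) (h.symForm_webCov hx) k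

end Web.IsNormalized

/-- The local connections with `θ = 0` are glued; being totally geodesic is a linear condition. -/
theorem Web.exists_isGeodesic [T2Space M] [SigmaCompactSpace M] (W : Web n M (n + 2)) :
    ∃ D : TorsionFreeConnection n M, W.IsGeodesic D := by
  choose U η e a hmem h using W.exists_isNormalized
  obtain ⟨D, hD⟩ := exists_torsionFreeConnection (fun p => (h p).isOpen) hmem
    (cov := fun p => webCov (η p) (e p) (a p) 0)
    (fun p x hx => (h p).isTorsionFreeAt_webCov hx)
    (fun p x hx => (h p).smoothCovAt_webCov hx (SmoothFormAt.zero x))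
  refine ⟨D, fun i x X Y hX hY hXi hYi => hD Y x (X x) _ fun p hx => ?_⟩
  exact (h p).geodesicAt_webCov hx i X Y hX hY hXi hYi

/-- The pointwise form of `IsGivenByForms`. -/
theorem Web.IsNormalized.isGivenByForms_iff {W : Web n M (n + 2)} {U : Set M}
    {η : Fin (n + 2) → OneForm n M} {e : Fin n → VField n M} {a : Fin n → M → ℝ} {θ : OneForm n M}
    (h : W.IsNormalized U η e a) {D : TorsionFreeConnection n M} : IsGivenByForms D U η e a θ ↔
      ∀ x (hx : x ∈ U) i u v, symForm (D.isTorsionFreeAt x) (h.smooth hx (Fin.castAdd 2 i)) u v =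
        symMul (formFactor η e a θ i x) (η (Fin.castAdd 2 i) x) u v := by
  constructor
  · intro hD x hx i
    exact (symForm_eq_iff (D.isTorsionFreeAt x) _ _).2 (hD i x hx)
  · intro hD i x hx
    exact (symForm_eq_iff (D.isTorsionFreeAt x) _ _).1 (hD x hx i)

/-- The antisymmetric coefficients `s_ij` drop out of the sum of the equations for `η_1, …, η_n`. -/
theorem Web.IsNormalized.symCovDiffEq_form_n {W : Web n M (n + 2)} {U : Set M}
    {η : Fin (n + 2) → OneForm n M} {e : Fin n → VField n M} {a : Fin n → M → ℝ} {θ : OneForm n M}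
    (h : W.IsNormalized U η e a) {D : TorsionFreeConnection n M}
    (hD : IsGivenByForms D U η e a θ) : SymCovDiffEq D U (η (Fin.natAdd n 0)) θ := by
  intro x hx
  refine (symForm_eq_iff (D.isTorsionFreeAt x) (h.smooth hx _) (symMul (θ x) (η _ x))).1
    fun u v => ?_
  rw [h.symForm_form_n hx]
  simp only [h.isGivenByForms_iff.1 hD x hx, formFactor, h.sCoeff_eq hx]
  rw [sum_symMul_eq, h.form_n hx]
  simp only [symMul, neg_apply]
  ring

end Global

end HypersurfaceWeb

end

theorem theorem3 (n : ℕ) (M : Type*) [TopologicalSpace M] [T2Space M] [SigmaCompactSpace M]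
    [ChartedSpace (EuclideanSpace ℝ (Fin n)) M] [IsManifold (𝓡 n) ∞ M] :
    -- every `(n+2)`-web determines a unique projective structure
    (∀ W : HypersurfaceWeb.Web n M (n + 2),
      ∃! P : HypersurfaceWeb.ProjectiveStructure n M, W.IsGeodesicIn P) ∧
    -- it consists of all torsion-free connections for which the leaves are totally geodesic
    (∀ (W : HypersurfaceWeb.Web n M (n + 2)) (P : HypersurfaceWeb.ProjectiveStructure n M),
      W.IsGeodesicIn P →
      ∀ D : HypersurfaceWeb.TorsionFreeConnection n M, D.projClass = P ↔ W.IsGeodesic D) ∧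
    -- normalized forms exist locally
    (∀ (W : HypersurfaceWeb.Web n M (n + 2)) (x : M), ∃ U η e a,
      x ∈ U ∧ W.IsNormalized U η e a) ∧
    -- it consists of the torsion-free connections given by forms `θ_i = θ + ∑ j, s_ij η_j`
    (∀ (W : HypersurfaceWeb.Web n M (n + 2)) (P : HypersurfaceWeb.ProjectiveStructure n M),
      W.IsGeodesicIn P →
      ∀ D : HypersurfaceWeb.TorsionFreeConnection n M, D.projClass = P ↔
        ∀ U η e a, W.IsNormalized U η e a →
          ∃ θ : HypersurfaceWeb.OneForm n M, (∀ x ∈ U, HypersurfaceWeb.SmoothFormAt θ x) ∧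
            HypersurfaceWeb.IsGivenByForms D U η e a θ) ∧
    -- the form `θ` is the form `θ_{n+1}` of the foliation number `n + 1`, and it determines
    -- the connection
    (∀ (W : HypersurfaceWeb.Web n M (n + 2)) U η e a, W.IsNormalized U η e a →
      ∀ θ : HypersurfaceWeb.OneForm n M, (∀ x ∈ U, HypersurfaceWeb.SmoothFormAt θ x) →
      ∀ D : HypersurfaceWeb.TorsionFreeConnection n M,
        HypersurfaceWeb.IsGivenByForms D U η e a θ →
        HypersurfaceWeb.SymCovDiffEq D U (η (Fin.natAdd n 0)) θ ∧
        ∀ D' : HypersurfaceWeb.TorsionFreeConnection n M,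
          HypersurfaceWeb.IsGivenByForms D' U η e a θ →
          ∀ x ∈ U, ∀ Y : HypersurfaceWeb.VField n M, HypersurfaceWeb.SmoothFieldAt Y x →
            D.cov Y x = D'.cov Y x) ∧
    -- for global normalized forms, every smooth one-form `θ` occurs
    (∀ (W : HypersurfaceWeb.Web n M (n + 2)) (P : HypersurfaceWeb.ProjectiveStructure n M),
      W.IsGeodesicIn P →
      ∀ η e a, W.IsNormalized Set.univ η e a →
      ∀ θ : HypersurfaceWeb.OneForm n M, (∀ x, HypersurfaceWeb.SmoothFormAt θ x) →
        ∃ D : HypersurfaceWeb.TorsionFreeConnection n M, D.projClass = P ∧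
          HypersurfaceWeb.IsGivenByForms D Set.univ η e a θ) ∧
    -- all `(n+2)`-subwebs of a geodesic `d`-web determine the same projective structure
    (∀ d : ℕ, n + 2 ≤ d → ∀ W : HypersurfaceWeb.Web n M d,
      (∃ D : HypersurfaceWeb.TorsionFreeConnection n M, W.IsGeodesic D) →
      ∃! P : HypersurfaceWeb.ProjectiveStructure n M,
        ∀ σ : Fin (n + 2) ↪ Fin d, (W.subweb σ).IsGeodesicIn P) := by
  refine ⟨fun W => ?_, fun W P hP D => hP.projClass_eq_iff, fun W x => W.exists_isNormalized x,
    fun W P hP D => ?_, fun W U η e a h θ _ D hD => ⟨?_, fun D' hD' x hx Y hY => ?_⟩,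
    fun W P hP η e a h θ hθ => ?_, fun d hd W ⟨D, hD⟩ => ?_⟩
  · obtain ⟨D, hD⟩ := W.exists_isGeodesic
    exact ⟨D.projClass, HypersurfaceWeb.Web.isGeodesicIn_projClass hD,
      fun P hP => (hP.projClass_eq_iff.2 hD).symm⟩
  · rw [hP.projClass_eq_iff, HypersurfaceWeb.Web.isGeodesic_iff]
    constructor
    · intro hD U η e a h
      exact ⟨_, fun x hx => h.smooth_thetaForm D hx, (h.isGivenByForms_iff).2 fun x hx =>
        h.symForm_of_geodesicAt hx (D.isTorsionFreeAt x) (hD x)⟩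
    · intro hD x
      obtain ⟨U, η, e, a, hx, h⟩ := W.exists_isNormalized x
      obtain ⟨θ, -, hθ⟩ := hD U η e a h
      exact h.geodesicAt_of_symForm hx (D.isTorsionFreeAt x) (θ x) (h.isGivenByForms_iff.1 hθ x hx)
  · exact h.symCovDiffEq_form_n hD
  · refine h.cov_eq_of_symForm_eq hx (fun i u v => ?_) hY
    rw [h.isGivenByForms_iff.1 hD x hx, h.isGivenByForms_iff.1 hD' x hx]
  · have hx (x : M) : x ∈ Set.univ := Set.mem_univ x
    refine ⟨.ofCov (HypersurfaceWeb.webCov η e a θ) (fun x => h.isTorsionFreeAt_webCov (hx x))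
      (fun x => h.smoothCovAt_webCov (hx x) (hθ x)), ?_, ?_⟩
    · exact hP.projClass_eq_iff.2 (HypersurfaceWeb.Web.isGeodesic_iff.2 fun x =>
        h.geodesicAt_webCov (hx x))
    · exact h.isGivenByForms_iff.2 fun x hx => h.symForm_webCov hx
  · have hsub (σ : Fin (n + 2) ↪ Fin d) : (W.subweb σ).IsGeodesic D := fun i => hD (σ i)
    refine ⟨D.projClass, fun σ => HypersurfaceWeb.Web.isGeodesicIn_projClass (hsub σ),
      fun P hP => ?_⟩
    exact ((hP (Fin.castLEEmb hd)).projClass_eq_iff.2 (hsub _)).symm
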